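/- Let $n\ge 2$, let $P$ be a real $n\times n$ matrix all of whose eigenvalues have positive real part, $A_t=t^P=\exp((\ln t)P)$ for $t>0$, and $\gamma=\operatorname{tr}P$. Let $\rho:\mathbb R^n\to[0,\infty)$ be a Borel measurable quasi-distance function associated with $P$: $\rho(A_tx)=t\rho(x)$ for $t>0$; $\rho(0)=0$; $\rho(x-y)=\rho(y-x)$; $\rho(x-y)\le k(\rho(x-z)+\rho(y-z))$ for some $k>0$; $c_1|x|^{\alpha_1}\le\rho(x)\le c_2|x|^{\alpha_2}$ if $\rho(x)\ge1$ and $c_3|x|^{\alpha_3}\le\rho(x)\le c_4|x|^{\alpha_4}$ if $\rho(x)\le1$, for some positive constants $c_i,\alpha_i$; and $\rho(\theta x)\le\rho(x)$ for $0<\theta<1$. Put $E(x,r)=\{y:\rho(x-y)<r\}$ and $E=E(x_0,r)$ when $x_0$ and $r$ are clear, $f_E=|E|^{-1}\int_E f$. Functions are real- or complex-valued, except that $\Omega,\varphi_1,\varphi_2$ are real-valued. For $1\le q<\infty$, $x_0\in\mathbb R^n$ and a positive measurable function $\varphi$ on $\mathbb R^n\times(0,\infty)$, let $LM_{q,\varphi,P}^{\{x_0\}}$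 be the space of $f\in L_q^{loc}(\mathbb R^n)$ with $$\|f\|_{LM_{q,\varphi,P}^{\{x_0\}}}=\sup_{r>0}\varphi(x_0,r)^{-1}|E(x_0,r)|^{-1/q}\|f\|_{L_q(E(x_0,r))}<\infty,$$ and for $0\le\lambda<1/\gamma$ let $LC_{q,\lambda,P}^{\{x_0\}}$ be the space of $b\in L_q^{loc}(\mathbb R^n)$ with $$\|b\|_{LC_{q,\lambda,P}^{\{x_0\}}}=\sup_{r>0}\Big(\frac1{|E(x_0,r)|^{1+\lambda q}}\int_{E(x_0,r)}|b(y)-b_{E(x_0,r)}|^q\,dy\Big)^{1/q}<\infty .$$ Let $1<s\le\infty$, $s'=s/(s-1)$ ($s'=1$ if $s=\infty$), and let $\Omega$ be a real measurable function on $\mathbb R^n$ with $\Omega(A_tx)=\Omega(x)$ for all $t>0$, $x\in\mathbb R^n$, and $\Omega\in L_s(S^{n-1})$. Let $T=T_\Omega^P$ be a linear operator which is bounded on $L_q(\mathbb R^n)$ for every $1<q<\infty$ and for which there is $c_0$ such that, for every compactly supported integrable $f$ belonging to some $L_q(\mathbb R^n)$, $1<q<\infty$, $$|Tf(x)|\le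 c_0\int_{\mathbb R^n}\frac{|\Omega(x-y)|}{\rho(x-y)^\gamma}|f(y)|\,dy\qquad\text{for a.e. }x\notin\operatorname{supp}f .$$ For a function $f$ that lies only locally in such a space, $Tf$ denotes the limit in $L_1^{loc}(\mathbb R^n)$ of $T(f\chi_{E(0,R)})$ as $R\to\infty$, when this limit exists; $[b,T]f=b\,Tf-T(bf)$, which is defined when the limits $Tf$ and $T(bf)$ both exist. Let $x_0\in\mathbb R^n$, $1<p<\infty$, $1\le p_1,p_2<\infty$, $\frac1p=\frac1{p_1}+\frac1{p_2}$, $0\le\lambda<\frac1\gamma$, and let $\varphi_1,\varphi_2$ be positive measurable functions on $\mathbb R^n\times(0,\infty)$. Suppose that at least one of the following holds, with a constant $C_0$ independent of $r$ (and $\gamma/s=0$ if $s=\infty$): (i) $s'\le p$ and, for all $r>0$, $$\int_r^\infty\Big(1+\ln\frac tr\Big)\frac{\operatorname*{ess\,inf}_{t<\tau<\infty}\varphi_1(x_0,\tau)\tau^{\gamma/p_1}}{t^{\frac\gamma{p_1}+1-\gamma\lambda}}\,dt\le C_0\,\varphi_2(x_0,r);$$ (ii) $p_1<s$ and, for all $r>0$,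 $$\int_r^\infty\Big(1+\ln\frac tr\Big)\frac{\operatorname*{ess\,inf}_{t<\tau<\infty}\varphi_1(x_0,\tau)\tau^{\gamma/p_1}}{t^{\frac\gamma{p_1}-\frac\gamma s+1-\gamma\lambda}}\,dt\le C_0\,\varphi_2(x_0,r)\,r^{\gamma/s}.$$ Then there is a constant $C$ such that for all $b\in LC_{p_2,\lambda,P}^{\{x_0\}}$ and all $f\in LM_{p_1,\varphi_1,P}^{\{x_0\}}$ the commutator $[b,T]f$ is defined, belongs to $LM_{p,\varphi_2,P}^{\{x_0\}}$, and satisfies $$\|[b,T]f\|_{LM_{p,\varphi_2,P}^{\{x_0\}}}\le C\,\|b\|_{LC_{p_2,\lambda,P}^{\{x_0\}}}\,\|f\|_{LM_{p_1,\varphi_1,P}^{\{x_0\}}}.$$ -/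

import Mathlib

open MeasureTheory Filter Topology
open scoped ENNReal NNReal Matrix

noncomputable section

namespace ParabolicMorrey

/-- `ℝⁿ` with its Euclidean norm. -/
abbrev E (n : ℕ) := EuclideanSpace ℝ (Fin n)

/-- The dilation `A_t = t^P = exp ((log t) P)` (for `t > 0`), acting on `ℝⁿ`. -/
def dilation {n : ℕ} (P : Matrix (Fin n) (Fin n) ℝ) (t : ℝ) (x : E n) : E n :=
  WithLp.toLp 2 (NormedSpace.exp (Real.log t • P) *ᵥ x.ofLp)

/-- All (complex) eigenvalues of the real matrix `P` have positive real part. -/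
def HasPositiveEigenvalues {n : ℕ} (P : Matrix (Fin n) (Fin n) ℝ) : Prop :=
  ∀ z ∈ spectrum ℂ (P.map (algebraMap ℝ ℂ)), 0 < z.re

/-- `ρ` is a quasi-distance on `ℝⁿ` associated with the matrix `P`; the distance between
`x` and `y` is `ρ (x - y)`. -/
structure IsQuasiDistance {n : ℕ} (P : Matrix (Fin n) (Fin n) ℝ) (ρ : E n → ℝ) : Prop where
  measurable : Measurable ρ
  homogeneous : ∀ t : ℝ, 0 < t → ∀ x, ρ (dilation P t x) = t * ρ x
  map_zero : ρ 0 = 0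
  nonneg : ∀ x, 0 ≤ ρ x
  symm : ∀ x y, ρ (x - y) = ρ (y - x)
  quasi_triangle : ∃ k : ℝ, 0 < k ∧ ∀ x y z, ρ (x - y) ≤ k * (ρ (x - z) + ρ (y - z))
  growth_large : ∃ c₁ c₂ α₁ α₂ : ℝ, 0 < c₁ ∧ 0 < c₂ ∧ 0 < α₁ ∧ 0 < α₂ ∧
    ∀ x, 1 ≤ ρ x → c₁ * ‖x‖ ^ α₁ ≤ ρ x ∧ ρ x ≤ c₂ * ‖x‖ ^ α₂
  growth_small : ∃ c₃ c₄ α₃ α₄ : ℝ, 0 < c₃ ∧ 0 < c₄ ∧ 0 < α₃ ∧ 0 < α₄ ∧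
    ∀ x, ρ x ≤ 1 → c₃ * ‖x‖ ^ α₃ ≤ ρ x ∧ ρ x ≤ c₄ * ‖x‖ ^ α₄
  star_shaped : ∀ θ : ℝ, 0 < θ → θ < 1 → ∀ x, ρ (θ • x) ≤ ρ x

/-- The ellipsoid `E(x, r) = {y : ρ (x - y) < r}`. -/
def ellipsoid {n : ℕ} (ρ : E n → ℝ) (x : E n) (r : ℝ) : Set (E n) :=
  {y | ρ (x - y) < r}

/-- `Ω` is a real measurable function, `A_t`-homogeneous of degree zero, in `L_s` of the
Euclidean unit sphere (normalizing the surface measure does not change this space). -/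
structure IsRoughKernel {n : ℕ} (P : Matrix (Fin n) (Fin n) ℝ) (s : ℝ≥0∞) (Ω : E n → ℝ) :
    Prop where
  measurable : Measurable Ω
  homogeneous : ∀ t : ℝ, 0 < t → ∀ x, Ω (dilation P t x) = Ω x
  memLp_sphere : MemLp (fun w : Metric.sphere (0 : E n) 1 => Ω w) s
    (volume : Measure (E n)).toSphere

section Operators

variable {n : ℕ} {𝕜 : Type*} [RCLike 𝕜]

/-- `T` is a linear operator which is bounded on `L_q(ℝⁿ)` for every `1 < q < ∞`. (Functions are
identified when equal almost everywhere; the values of `T` outside these spaces play no role.) -/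
structure IsBoundedLinear (T : (E n → 𝕜) → (E n → 𝕜)) : Prop where
  map_add : ∀ q : ℝ≥0∞, 1 < q → q < ∞ → ∀ f g : E n → 𝕜, MemLp f q volume → MemLp g q volume →
    T (f + g) =ᵐ[volume] T f + T g
  map_smul : ∀ q : ℝ≥0∞, 1 < q → q < ∞ → ∀ (c : 𝕜) (f : E n → 𝕜), MemLp f q volume →
    T (c • f) =ᵐ[volume] c • T f
  bounded : ∀ q : ℝ≥0∞, 1 < q → q < ∞ → ∃ C : ℝ≥0, ∀ f : E n → 𝕜, MemLp f q volume →
    MemLp (T f) q volume ∧ eLpNorm (T f) q volume ≤ C * eLpNorm f q volume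

/-- The size condition `|T f(x)| ≤ c₀ ∫ |Ω(x-y)| ρ(x-y)^{-γ} |f(y)| dy` for compactly supported
integrable `f` (lying in the domain of `T`) and almost all `x` outside the support of `f`. -/
def SizeCondition (P : Matrix (Fin n) (Fin n) ℝ) (ρ Ω : E n → ℝ)
    (T : (E n → 𝕜) → (E n → 𝕜)) : Prop :=
  ∃ c₀ : ℝ≥0, ∀ f : E n → 𝕜, HasCompactSupport f → Integrable f volume →
    (∃ q : ℝ≥0∞, 1 < q ∧ q < ∞ ∧ MemLp f q volume) →
    ∀ᵐ x ∂(volume : Measure (E n)), x ∉ tsupport f →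
      ‖T f x‖ₑ ≤ c₀ * ∫⁻ y, ENNReal.ofReal (|Ω (x - y)| / ρ (x - y) ^ P.trace) * ‖f y‖ₑ

/-- `f ∈ L_p^loc(ℝⁿ)`. -/
def MemLpLoc (f : E n → 𝕜) (p : ℝ≥0∞) : Prop :=
  ∀ K : Set (E n), IsCompact K → MemLp f p (volume.restrict K)

/-- `T f = g` for a function `f` which need not belong to any `L_q(ℝⁿ)`: the functions
`T (f χ_{E(0,R)})` converge to `g` in `L_1^loc(ℝⁿ)` as `R → ∞`. Such a `g` is unique up to null
sets. -/
def HasValue (ρ : E n → ℝ) (T : (E n → 𝕜) → (E n → 𝕜)) (f g : E n → 𝕜) : Prop :=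
  AEStronglyMeasurable g volume ∧
  ∀ K : Set (E n), IsCompact K →
    Tendsto (fun R : ℝ => eLpNorm (T ((ellipsoid ρ 0 R).indicator f) - g) 1 (volume.restrict K))
      atTop (𝓝 0)

/-- `u = [b, T] f = b T f - T (b f)`. -/
def IsCommutator (ρ : E n → ℝ) (b : E n → 𝕜) (T : (E n → 𝕜) → (E n → 𝕜)) (f u : E n → 𝕜) :
    Prop :=
  ∃ g h : E n → 𝕜, HasValue ρ T f g ∧ HasValue ρ T (b * f) h ∧ u =ᵐ[volume] b * g - h

/-- The norm of the parabolic generalized local Morrey space `LM_{p,φ,P}^{x₀}`: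
`sup_{r>0} φ(x₀,r)⁻¹ |E(x₀,r)|^{-1/p} ‖f‖_{L_p(E(x₀,r))}`. -/
def morreyNorm (ρ : E n → ℝ) (x₀ : E n) (p : ℝ) (φ : E n → ℝ → ℝ) (f : E n → 𝕜) : ℝ≥0∞ :=
  ⨆ (r : ℝ) (_ : 0 < r), (ENNReal.ofReal (φ x₀ r))⁻¹ * volume (ellipsoid ρ x₀ r) ^ (-(1 / p)) *
    eLpNorm f (ENNReal.ofReal p) (volume.restrict (ellipsoid ρ x₀ r))

/-- Membership in `LM_{p,φ,P}^{x₀}`. -/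
def MemMorrey (ρ : E n → ℝ) (x₀ : E n) (p : ℝ) (φ : E n → ℝ → ℝ) (f : E n → 𝕜) : Prop :=
  MemLpLoc f (ENNReal.ofReal p) ∧ morreyNorm ρ x₀ p φ f < ∞

/-- The (semi)norm of the parabolic local Campanato space `LC_{p,lam,P}^{x₀}`:
`sup_{r>0} ( |E|^{-(1 + lam p)} ∫_E |f - f_E|^p )^{1/p}` with `E = E(x₀,r)`. -/
def campanatoNorm (ρ : E n → ℝ) (x₀ : E n) (p lam : ℝ) (f : E n → 𝕜) : ℝ≥0∞ :=
  ⨆ (r : ℝ) (_ : 0 < r), (volume (ellipsoid ρ x₀ r) ^ (-(1 + lam * p)) *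
    ∫⁻ y in ellipsoid ρ x₀ r, ‖f y - ⨍ z in ellipsoid ρ x₀ r, f z‖ₑ ^ p) ^ (1 / p)

/-- Membership in `LC_{p,lam,P}^{x₀}`. -/
def MemCampanato (ρ : E n → ℝ) (x₀ : E n) (p lam : ℝ) (f : E n → 𝕜) : Prop :=
  MemLpLoc f (ENNReal.ofReal p) ∧ campanatoNorm ρ x₀ p lam f < ∞

end Operators

/-- `φ` is a positive measurable function on `ℝⁿ × (0, ∞)`. -/
def IsWeight {n : ℕ} (φ : E n → ℝ → ℝ) : Prop :=
  Measurable (fun z : E n × Set.Ioi (0 : ℝ) => φ z.1 z.2) ∧ ∀ x r, 0 < r → 0 < φ x r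

/-- There is `C > 0` such that for all `r > 0`
`∫_r^∞ (1 + ln (t/r)) (essinf_{t<τ<∞} φ₁(x₀,τ) τ^{γ/p₁}) / t^{γ/p₁ - σ + 1 - γ lam} dt
  ≤ C φ₂(x₀,r) r^σ`. -/
def LogEssInfCondition {n : ℕ} (x₀ : E n) (γ p₁ lam σ : ℝ) (φ₁ φ₂ : E n → ℝ → ℝ) : Prop :=
  ∃ C : ℝ, 0 < C ∧ ∀ r : ℝ, 0 < r →
    ∫⁻ t in Set.Ioi r, ENNReal.ofReal (1 + Real.log (t / r)) *
        essInf (fun τ : ℝ => ENNReal.ofReal (φ₁ x₀ τ * τ ^ (γ / p₁)))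
          (volume.restrict (Set.Ioi t)) /
        ENNReal.ofReal (t ^ (γ / p₁ - σ + 1 - γ * lam))
      ≤ ENNReal.ofReal (C * φ₂ x₀ r * r ^ σ)

end ParabolicMorrey

end

/-! Since `det (exp (u P)) = exp (u tr P)`, an ellipsoid of radius `r` has volume `V r^γ`, and
generalized polar coordinates bound the `L_s` norm of `Ω` on the shell of radius `R` by a multiple
of `R^(γ/s)`. Let `g` live on a shell of radius `R ≥ 4 k r` about `x₀`. By the size condition, the
`L_q` norm of `T g` on `E(x₀,r)` is at most `C (R/r)^(σ - γ/q) ‖g‖_q`. Here `σ = 0` when `s' ≤ q`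
(Hölder in `y`), and `σ = γ/s` when `q ≤ s` (Hölder on the support of `g`, then Tonelli). Splitting
a function into a core, controlled by global boundedness, and dyadic shells yields
`exists_eLpNorm_le_dyadicSum`. The same bound, applied to tails, makes the truncated values Cauchy
in `L_1^loc` (`exists_hasValue`).

The commutator does not change when a constant is subtracted from `b`. Take the average `β` over
`E(x₀, 4kr)`. Then `(b - β) T g` is handled by Hölder and the `L_{p₁}` bound, and `T ((b - β) g)` by
the `L_p` bound with Hölder on each dyadic ellipsoid. Averages of `b` over `j` successive doublings
drift by at most `j` times the last increment bound (`exists_enorm_average_sub_average_le`). This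
produces the factor `1 + j`, the discrete form of the logarithm.

The resulting sum is compared with the integral in the hypothesis: on the `j`-th dyadic interval `1
+ j` is at most `2 (1 + ln (t/r))`, and the norm of `f` over `E(x₀,t)`, being monotone in `t`, is
bounded by the essential infimum over larger radii (`exists_logSum_le`). All bounds are uniform over
truncations of `f`, so almost everywhere convergence along a subsequence and Fatou transfer them to
`[b,T]f`. -/

noncomputable section

namespace ParabolicMorrey

section

/-! ### The determinant of the matrix exponential -/

section MatrixExponential

attribute [local instance] Matrix.linftyOpNormedRing Matrix.linftyOpNormedAlgebra

variable {n : ℕ}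

theorem hasDerivAt_exp_smul_matrix (P : Matrix (Fin n) (Fin n) ℝ) (t : ℝ) :
    HasDerivAt (fun t : ℝ => NormedSpace.exp (t • P)) (NormedSpace.exp (t • P) * P) t :=
  hasDerivAt_exp_smul_const P t

theorem differentiable_det : Differentiable ℝ (fun M : Matrix (Fin n) (Fin n) ℝ => M.det) := by
  simp only [Matrix.det_apply']
  have h : ∀ i j : Fin n, Differentiable ℝ (fun M : Matrix (Fin n) (Fin n) ℝ => M i j) := by
    intro i j
    exact ((Matrix.entryLinearMap ℝ ℝ i j).toContinuousLinearMap).differentiable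
  fun_prop

/-- The curves `exp (t P)` and `1 + t P` agree to first order at `t = 0`, so by the chain rule their
determinants have the same derivative there. For the second curve it is read off the polynomial `det
(1 + X P)`. -/
theorem hasDerivAt_det_exp_smul_zero (P : Matrix (Fin n) (Fin n) ℝ) :
    HasDerivAt (fun t : ℝ => (NormedSpace.exp (t • P)).det) P.trace 0 := by
  have hd := (differentiable_det (n := n) 1).hasFDerivAt
  have h1 : HasDerivAt (fun t : ℝ => 1 + t • P) P 0 := by
    refine HasDerivAt.const_add 1 ?_
    simpa using (hasDerivAt_id (0 : ℝ)).smul_const P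
  have h2 : HasDerivAt (fun t : ℝ => NormedSpace.exp (t • P)) P 0 := by
    simpa using hasDerivAt_exp_smul_matrix P 0
  have h3 : HasDerivAt (fun t : ℝ => (1 + t • P).det) P.trace 0 := by
    have h := (1 + (Polynomial.X : Polynomial ℝ) • P.map Polynomial.C).det.hasDerivAt 0
    rw [Matrix.derivative_det_one_add_X_smul P] at h
    refine h.congr_of_eventuallyEq (Eventually.of_forall fun t => ?_)
    simp only
    rw [← Polynomial.coe_evalRingHom, RingHom.map_det]
    congr 1
    ext i j
    simp only [Matrix.add_apply, Matrix.smul_apply, RingHom.mapMatrix_apply, Matrix.map_apply,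
      Matrix.one_apply, smul_eq_mul, Polynomial.coe_evalRingHom, Polynomial.eval_add,
      Polynomial.eval_mul, Polynomial.eval_X, Polynomial.eval_C]
    split_ifs <;> simp
  have h4 := HasFDerivAt.comp_hasDerivAt (0 : ℝ) (f := fun t : ℝ => 1 + t • P)
    (by rw [zero_smul, add_zero]; exact hd) h1
  have h5 := HasFDerivAt.comp_hasDerivAt (0 : ℝ) (f := fun t : ℝ => NormedSpace.exp (t • P))
    (by rw [zero_smul, NormedSpace.exp_zero]; exact hd) h2
  rw [h3.unique h4]
  exact h5

/-- The group law transports the derivative at `0` to every `s`, so the determinant solves `D' = (tr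
P) D`. Multiplying by the expected inverse gives a function with zero derivative. -/
theorem det_exp_smul (P : Matrix (Fin n) (Fin n) ℝ) (t : ℝ) :
    (NormedSpace.exp (t • P)).det = Real.exp (t * P.trace) := by
  have hD : ∀ s : ℝ, HasDerivAt (fun t : ℝ => (NormedSpace.exp (t • P)).det)
      ((NormedSpace.exp (s • P)).det * P.trace) s := by
    intro s
    have h0 := hasDerivAt_det_exp_smul_zero P
    have h1 : HasDerivAt (fun t : ℝ => (NormedSpace.exp ((t - s) • P)).det) P.trace s := by
      have := HasDerivAt.comp_sub_const (f := fun t : ℝ => (NormedSpace.exp (t • P)).det) s s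
        (by simpa using h0)
      simpa using this
    refine (h1.const_mul ((NormedSpace.exp (s • P)).det)).congr_of_eventuallyEq
      (Eventually.of_forall fun u => ?_)
    simp only
    rw [← Matrix.det_mul, ← Matrix.exp_add_of_commute, ← add_smul]
    · congr 3; ring
    · exact (Commute.refl P).smul_left _ |>.smul_right _
  have hE : ∀ s : ℝ, HasDerivAt
      (fun t : ℝ => (NormedSpace.exp (t • P)).det * Real.exp (-(t * P.trace))) 0 s := by
    intro s
    have := (hD s).mul (((hasDerivAt_id s).mul_const P.trace).neg.exp)
    refine this.congr_deriv ?_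
    simp only [Pi.neg_apply]
    ring
  have := is_const_of_deriv_eq_zero (fun s => (hE s).differentiableAt) (fun s => (hE s).deriv) t 0
  simp [Real.exp_neg] at this
  field_simp at this
  exact this

end MatrixExponential

/-! ### Topology and volume of the ellipsoids -/

variable {n : ℕ} {P : Matrix (Fin n) (Fin n) ℝ} {ρ : E n → ℝ}

/-- The dilation as a linear map. -/
def dilationLM (P : Matrix (Fin n) (Fin n) ℝ) (t : ℝ) : E n →ₗ[ℝ] E n :=
  Matrix.toEuclideanLin (NormedSpace.exp (Real.log t • P))

theorem det_dilationLM (P : Matrix (Fin n) (Fin n) ℝ) {t : ℝ} (ht : 0 < t) :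
    LinearMap.det (dilationLM P t) = t ^ P.trace := by
  rw [dilationLM, Matrix.toEuclideanLin, LinearMap.det_toLpLin, det_exp_smul,
    Real.rpow_def_of_pos ht]

theorem continuous_dilation (P : Matrix (Fin n) (Fin n) ℝ) (t : ℝ) :
    Continuous (dilation P t) :=
  (dilationLM P t).continuous_of_finiteDimensional

theorem dilation_dilation (P : Matrix (Fin n) (Fin n) ℝ) {s t : ℝ} (hs : 0 < s) (ht : 0 < t)
    (x : E n) : dilation P s (dilation P t x) = dilation P (s * t) x := by
  simp only [dilation, Matrix.mulVec_mulVec]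
  rw [Real.log_mul hs.ne' ht.ne', add_smul, Matrix.exp_add_of_commute]
  exact ((Commute.refl P).smul_left _).smul_right _

theorem dilation_one (P : Matrix (Fin n) (Fin n) ℝ) (x : E n) : dilation P 1 x = x := by
  simp [dilation]

theorem map_dilation_volume (P : Matrix (Fin n) (Fin n) ℝ) {t : ℝ} (ht : 0 < t) :
    Measure.map (dilation P t) volume
      = ENNReal.ofReal (t ^ (-P.trace)) • (volume : Measure (E n)) := by
  have h := Measure.map_linearMap_addHaar_eq_smul_addHaar (volume : Measure (E n))
    (f := dilationLM P t) (by rw [det_dilationLM P ht]; positivity)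
  rw [det_dilationLM P ht, ← Real.rpow_neg ht.le, abs_of_pos (by positivity)] at h
  exact h

theorem IsQuasiDistance.neg (hρ : IsQuasiDistance P ρ) (x : E n) : ρ (-x) = ρ x := by
  simpa using hρ.symm 0 x

theorem IsQuasiDistance.pos (hρ : IsQuasiDistance P ρ) {x : E n} (hx : x ≠ 0) : 0 < ρ x := by
  rcases le_total 1 (ρ x) with h | h
  · linarith
  · obtain ⟨c₃, c₄, α₃, α₄, h3, h4, a3, a4, H⟩ := hρ.growth_small
    have : 0 < ‖x‖ := norm_pos_iff.2 hx
    exact lt_of_lt_of_le (by positivity) (H x h).1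

theorem IsQuasiDistance.exists_norm_le (hρ : IsQuasiDistance P ρ) (R : ℝ) :
    ∃ M : ℝ, ∀ x, ρ x ≤ R → ‖x‖ ≤ M := by
  obtain ⟨c₁, c₂, α₁, α₂, h1, h2, a1, a2, H⟩ := hρ.growth_large
  obtain ⟨c₃, c₄, α₃, α₄, h3, h4, a3, a4, H'⟩ := hρ.growth_small
  have key : ∀ c α : ℝ, 0 < c → 0 < α → ∀ x : E n, c * ‖x‖ ^ α ≤ ρ x → ρ x ≤ R →
      ‖x‖ ≤ (R / c) ^ α⁻¹ := by
    intro c α hc hα x hx hR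
    rw [Real.le_rpow_inv_iff_of_pos (norm_nonneg _) _ hα, le_div_iff₀ hc]
    · linarith
    · exact div_nonneg ((hρ.nonneg x).trans hR) hc.le
  refine ⟨max ((R / c₁) ^ α₁⁻¹) ((R / c₃) ^ α₃⁻¹), fun x hx => ?_⟩
  rcases le_total 1 (ρ x) with h | h
  · exact (key c₁ α₁ h1 a1 x (H x h).1 hx).trans (le_max_left _ _)
  · exact (key c₃ α₃ h3 a3 x (H' x h).1 hx).trans (le_max_right _ _)

theorem IsQuasiDistance.exists_le_norm_rpow (hρ : IsQuasiDistance P ρ) :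
    ∃ c₂ c₄ α₂ α₄ : ℝ, 0 < c₂ ∧ 0 < c₄ ∧ 0 < α₂ ∧ 0 < α₄ ∧
      ∀ x, ρ x ≤ c₂ * ‖x‖ ^ α₂ + c₄ * ‖x‖ ^ α₄ := by
  obtain ⟨c₁, c₂, α₁, α₂, h1, h2, a1, a2, H⟩ := hρ.growth_large
  obtain ⟨c₃, c₄, α₃, α₄, h3, h4, a3, a4, H'⟩ := hρ.growth_small
  refine ⟨c₂, c₄, α₂, α₄, h2, h4, a2, a4, fun x => ?_⟩
  have e2 : 0 ≤ c₂ * ‖x‖ ^ α₂ := by positivity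
  have e4 : 0 ≤ c₄ * ‖x‖ ^ α₄ := by positivity
  rcases le_total 1 (ρ x) with h | h
  · linarith [(H x h).2]
  · linarith [(H' x h).2]

theorem IsQuasiDistance.exists_le_of_norm_le (hρ : IsQuasiDistance P ρ) (M : ℝ) :
    ∃ R : ℝ, 0 < R ∧ ∀ x, ‖x‖ ≤ M → ρ x < R := by
  obtain ⟨c₂, c₄, α₂, α₄, h2, h4, a2, a4, H⟩ := hρ.exists_le_norm_rpow
  refine ⟨c₂ * (max M 0) ^ α₂ + c₄ * (max M 0) ^ α₄ + 1, by positivity, fun x hx => ?_⟩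
  have hx' : ‖x‖ ≤ max M 0 := hx.trans (le_max_left _ _)
  have e2 : ‖x‖ ^ α₂ ≤ (max M 0) ^ α₂ := by gcongr
  have e4 : ‖x‖ ^ α₄ ≤ (max M 0) ^ α₄ := by gcongr
  nlinarith [H x]

/-- A quasi-distance is only Borel measurable, but its upper growth bounds give continuity at the
origin. This suffices to make every ellipsoid a neighbourhood of its centre. -/
theorem IsQuasiDistance.tendsto_zero (hρ : IsQuasiDistance P ρ) : Tendsto ρ (𝓝 0) (𝓝 0) := by
  obtain ⟨c₂, c₄, α₂, α₄, h2, h4, a2, a4, H⟩ := hρ.exists_le_norm_rpow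
  have hc : Continuous fun x : E n => c₂ * ‖x‖ ^ α₂ + c₄ * ‖x‖ ^ α₄ := by
    have : ∀ α : ℝ, 0 < α → Continuous fun x : E n => ‖x‖ ^ α := fun α hα =>
      continuous_norm.rpow_const fun _ => Or.inr hα.le
    exact ((this _ a2).const_mul _).add ((this _ a4).const_mul _)
  have h0 := hc.tendsto 0
  simp only [norm_zero, Real.zero_rpow a2.ne', Real.zero_rpow a4.ne', mul_zero, add_zero] at h0
  exact squeeze_zero hρ.nonneg H h0

/-- The quasi-triangle inequality with a constant which is at least one. -/
theorem IsQuasiDistance.exists_triangle (hρ : IsQuasiDistance P ρ) :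
    ∃ k : ℝ, 1 ≤ k ∧ ∀ x y, ρ (x + y) ≤ k * (ρ x + ρ y) := by
  obtain ⟨k, hk, H⟩ := hρ.quasi_triangle
  refine ⟨max k 1, le_max_right _ _, fun x y => ?_⟩
  have := H x (-y) 0
  rw [sub_neg_eq_add, sub_zero, sub_zero, hρ.neg] at this
  exact this.trans (mul_le_mul_of_nonneg_right (le_max_left _ _)
    (add_nonneg (hρ.nonneg x) (hρ.nonneg y)))

theorem mem_ellipsoid {x y : E n} {r : ℝ} : y ∈ ellipsoid ρ x r ↔ ρ (x - y) < r := Iff.rfl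

theorem ellipsoid_mono (x : E n) {r R : ℝ} (h : r ≤ R) : ellipsoid ρ x r ⊆ ellipsoid ρ x R :=
  fun _ hy => lt_of_lt_of_le hy h

theorem IsQuasiDistance.measurableSet_ellipsoid (hρ : IsQuasiDistance P ρ) (x : E n) (r : ℝ) :
    MeasurableSet (ellipsoid ρ x r) :=
  measurableSet_lt (hρ.measurable.comp (measurable_const.sub measurable_id)) measurable_const

theorem IsQuasiDistance.isBounded_ellipsoid (hρ : IsQuasiDistance P ρ) (x : E n) (r : ℝ) :
    Bornology.IsBounded (ellipsoid ρ x r) := by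
  obtain ⟨M, hM⟩ := hρ.exists_norm_le r
  refine (Metric.isBounded_iff_subset_closedBall x).2 ⟨M, fun y hy => ?_⟩
  rw [Metric.mem_closedBall, dist_comm, dist_eq_norm]
  exact hM _ (le_of_lt hy)

theorem IsQuasiDistance.exists_subset_ellipsoid (hρ : IsQuasiDistance P ρ) (x : E n) {K : Set (E n)}
    (hK : Bornology.IsBounded K) : ∃ r, 0 < r ∧ K ⊆ ellipsoid ρ x r := by
  obtain ⟨M, hM⟩ := (Metric.isBounded_iff_subset_closedBall x).1 hK
  obtain ⟨r, hr, H⟩ := hρ.exists_le_of_norm_le M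
  refine ⟨r, hr, fun y hy => H _ ?_⟩
  have := hM hy
  rwa [Metric.mem_closedBall, dist_comm, dist_eq_norm] at this

theorem IsQuasiDistance.preimage_dilation_ellipsoid (hρ : IsQuasiDistance P ρ) {t : ℝ} (ht : 0 < t)
    (r : ℝ) : dilation P t ⁻¹' (ellipsoid ρ 0 r) = ellipsoid ρ 0 (r / t) := by
  ext x
  simp only [Set.mem_preimage, mem_ellipsoid, zero_sub, hρ.neg, hρ.homogeneous t ht]
  rw [lt_div_iff₀ ht, mul_comm]

/-- The volume of the unit ellipsoid. -/
def unitVolume (ρ : E n → ℝ) : ℝ := (volume (ellipsoid ρ 0 1)).toReal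

theorem IsQuasiDistance.volume_ellipsoid_ne_top (hρ : IsQuasiDistance P ρ) (x : E n) (r : ℝ) :
    volume (ellipsoid ρ x r) ≠ ∞ := (hρ.isBounded_ellipsoid x r).measure_lt_top.ne

theorem IsQuasiDistance.ellipsoid_zero_mem_nhds (hρ : IsQuasiDistance P ρ) {r : ℝ} (hr : 0 < r) :
    ellipsoid ρ 0 r ∈ 𝓝 (0 : E n) := by
  have := hρ.tendsto_zero.eventually (gt_mem_nhds hr)
  filter_upwards [this] with y hy
  simpa [mem_ellipsoid, hρ.neg] using hy

theorem IsQuasiDistance.unitVolume_pos (hρ : IsQuasiDistance P ρ) : 0 < unitVolume ρ :=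
  ENNReal.toReal_pos (Measure.measure_pos_of_mem_nhds _ (hρ.ellipsoid_zero_mem_nhds one_pos)).ne'
    (hρ.volume_ellipsoid_ne_top 0 1)

/-- After translation to the origin, `E(0,r)` is the preimage of `E(0,1)` under `A_{1/r}`, which
pushes Lebesgue measure forward to `r^γ` times itself. -/
theorem IsQuasiDistance.volume_ellipsoid (hρ : IsQuasiDistance P ρ) (x : E n) {r : ℝ}
    (hr : 0 < r) : volume (ellipsoid ρ x r) = ENNReal.ofReal (unitVolume ρ * r ^ P.trace) := by
  have h1 : volume (ellipsoid ρ x r) = volume (ellipsoid ρ 0 r) := by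
    have : ellipsoid ρ x r = (fun y => y - x) ⁻¹' (ellipsoid ρ 0 r) := by
      ext y; simp [mem_ellipsoid]
    rw [this]
    exact (measurePreserving_sub_right volume x).measure_preimage
      (hρ.measurableSet_ellipsoid 0 r).nullMeasurableSet
  have h2 := congrArg (fun μ => μ (ellipsoid ρ 0 1)) (map_dilation_volume P (inv_pos.2 hr))
  rw [Measure.map_apply (continuous_dilation P _).measurable (hρ.measurableSet_ellipsoid 0 1),
    hρ.preimage_dilation_ellipsoid (inv_pos.2 hr), Measure.smul_apply, smul_eq_mul] at h2
  rw [h1, unitVolume, mul_comm, ENNReal.ofReal_mul (by positivity),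
    ENNReal.ofReal_toReal (hρ.volume_ellipsoid_ne_top 0 1)]
  rw [Real.inv_rpow hr.le, Real.rpow_neg hr.le, inv_inv] at h2
  simpa using h2

/-- The nested ellipsoids of radii `1` and `2` have volumes in the ratio `2^γ`. -/
theorem IsQuasiDistance.trace_nonneg (hρ : IsQuasiDistance P ρ) : 0 ≤ P.trace := by
  have h := measure_mono (μ := volume) (ellipsoid_mono (ρ := ρ) 0 (one_le_two (α := ℝ)))
  have hV := hρ.unitVolume_pos
  rw [hρ.volume_ellipsoid 0 one_pos, hρ.volume_ellipsoid 0 two_pos,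
    ENNReal.ofReal_le_ofReal_iff (by positivity), Real.one_rpow] at h
  have h2 : (1 : ℝ) ≤ 2 ^ P.trace := le_of_mul_le_mul_left h hV
  by_contra hneg
  push Not at hneg
  have := Real.rpow_lt_one_of_one_lt_of_neg (one_lt_two (α := ℝ)) hneg
  linarith

end

/-! ### Generalized polar coordinates and the size of `Ω` on shells -/

section

variable {n : ℕ} {P : Matrix (Fin n) (Fin n) ℝ} {ρ : E n → ℝ}

section Polar

attribute [local instance] Matrix.linftyOpNormedRing Matrix.linftyOpNormedAlgebra

theorem contDiff_dilation_exp (P : Matrix (Fin n) (Fin n) ℝ) :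
    ContDiff ℝ 1 fun z : ℝ × E n =>
      Matrix.toEuclideanLin (NormedSpace.exp (z.1 • P)) z.2 := by
  let L : Matrix (Fin n) (Fin n) ℝ →L[ℝ] (E n →L[ℝ] E n) :=
    LinearMap.toContinuousLinearMap
      ((Matrix.toEuclideanLin.trans LinearMap.toContinuousLinearMap).toLinearMap)
  have h1 : ContDiff ℝ 1 fun u : ℝ => NormedSpace.exp (u • P) := by
    have : ContDiff ℝ 1 (NormedSpace.exp : Matrix (Fin n) (Fin n) ℝ → _) :=
      contDiff_iff_contDiffAt.2 fun x => (NormedSpace.exp_analytic (𝕂 := ℝ) x).contDiffAt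
    exact this.comp (contDiff_id.smul contDiff_const)
  exact (L.contDiff.comp (h1.comp contDiff_fst)).clm_apply contDiff_snd

end Polar

/-- Generalized polar coordinates, written on the whole punctured space. -/
def polarMap (P : Matrix (Fin n) (Fin n) ℝ) (y : E n) : E n := dilation P ‖y‖ (‖y‖⁻¹ • y)

theorem contDiffOn_polarMap (P : Matrix (Fin n) (Fin n) ℝ) :
    ContDiffOn ℝ 1 (polarMap P) {0}ᶜ := by
  have h1 : ContDiffOn ℝ 1 (fun y : E n => (Real.log ‖y‖, ‖y‖⁻¹ • y)) {0}ᶜ := by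
    have hn : ContDiffOn ℝ 1 (fun y : E n => ‖y‖) {0}ᶜ := fun y hy =>
      (contDiffAt_norm ℝ hy).contDiffWithinAt
    have h0 : ∀ y ∈ ({0}ᶜ : Set (E n)), ‖y‖ ≠ 0 := fun y hy => norm_ne_zero_iff.2 hy
    exact (hn.log h0).prodMk ((hn.inv h0).smul contDiffOn_id)
  exact (contDiff_dilation_exp P).comp_contDiffOn h1

theorem exists_det_fderiv_polarMap_le (P : Matrix (Fin n) (Fin n) ℝ) {α : ℝ} (hα : 0 < α) (β : ℝ) :
    ∃ C : ℝ, 0 ≤ C ∧ ∀ y : E n, α ≤ ‖y‖ → ‖y‖ ≤ β → |(fderiv ℝ (polarMap P) y).det| ≤ C := by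
  have hc : ContinuousOn (fun y => (fderiv ℝ (polarMap P) y).det) {0}ᶜ :=
    ContinuousLinearMap.continuous_det.comp_continuousOn
      ((contDiffOn_polarMap P).continuousOn_fderiv_of_isOpen isOpen_compl_singleton le_rfl)
  have hK : IsCompact (Metric.closedBall (0 : E n) β ∩ {y | α ≤ ‖y‖}) :=
    (isCompact_closedBall _ _).inter_right (isClosed_le continuous_const continuous_norm)
  obtain ⟨C, hC⟩ := hK.exists_bound_of_continuousOn (hc.mono fun y hy => by
    have := hα.trans_le hy.2
    simpa using this)
  refine ⟨max C 0, le_max_right _ _, fun y h1 h2 => ?_⟩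
  exact (hC y ⟨by simpa using h2, h1⟩).trans (le_max_left _ _)

/-- Every orbit of the dilations meets the Euclidean unit sphere. -/
theorem IsQuasiDistance.exists_norm_dilation_eq_one (hρ : IsQuasiDistance P ρ) {x : E n}
    (hx : x ≠ 0) : ∃ t : ℝ, 0 < t ∧ ‖dilation P t x‖ = 1 := by
  have hpos := hρ.pos hx
  have hc : ContinuousOn (fun t : ℝ => ‖dilation P t x‖) (Set.Ioi 0) := by
    have h : ContinuousOn (fun t : ℝ => (Real.log t, x)) (Set.Ioi 0) :=
      (Real.continuousOn_log.mono fun t ht => ne_of_gt ht).prodMk continuousOn_const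
    exact continuous_norm.comp_continuousOn
      ((contDiff_dilation_exp P).continuous.comp_continuousOn h)
  obtain ⟨R, hR, H⟩ := hρ.exists_le_of_norm_le 1
  have hsmall : ∃ t : ℝ, 0 < t ∧ ‖dilation P t x‖ ≤ 1 := by
    obtain ⟨c₃, c₄, α₃, α₄, h3, h4, a3, a4, H'⟩ := hρ.growth_small
    -- This `t` makes `ρ (A_t x) = min 1 c₃`: being at most `1` activates the small-scale growth
    -- bound, and being at most `c₃` then forces norm at most `1`.
    refine ⟨min 1 c₃ / ρ x, by positivity, ?_⟩
    have e := hρ.homogeneous (min 1 c₃ / ρ x) (by positivity) x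
    rw [div_mul_cancel₀ _ hpos.ne'] at e
    have h := (H' _ (e.trans_le (min_le_left _ _))).1
    rw [e] at h
    have h' : c₃ * ‖dilation P (min 1 c₃ / ρ x) x‖ ^ α₃ ≤ c₃ * 1 :=
      h.trans ((min_le_right _ _).trans_eq (mul_one _).symm)
    have h'' := le_of_mul_le_mul_left h' h3
    by_contra hlt
    push Not at hlt
    exact absurd h'' (not_le.2 (Real.one_lt_rpow hlt a3))
  -- Here `ρ (A_t x) = R`, a value not reached by any vector of norm at most `1`.
  have hlarge : 1 ≤ ‖dilation P (R / ρ x) x‖ := by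
    by_contra hlt
    push Not at hlt
    have := H _ hlt.le
    rw [hρ.homogeneous _ (by positivity), div_mul_cancel₀ _ hpos.ne'] at this
    exact lt_irrefl _ this
  obtain ⟨t, ht, hle⟩ := hsmall
  obtain ⟨u, hu, hu'⟩ := isPreconnected_Ioi.intermediate_value (s := Set.Ioi (0 : ℝ)) ht
    (show R / ρ x ∈ Set.Ioi (0 : ℝ) from by simpa using by positivity) hc ⟨hle, hlarge⟩
  exact ⟨u, hu, hu'⟩

theorem IsQuasiDistance.exists_sphere_bounds (hρ : IsQuasiDistance P ρ) :
    ∃ m M : ℝ, 0 < m ∧ 0 < M ∧ ∀ w : E n, ‖w‖ = 1 → m ≤ ρ w ∧ ρ w ≤ M := by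
  obtain ⟨R, hR, H⟩ := hρ.exists_le_of_norm_le 1
  obtain ⟨c₁, c₂, α₁, α₂, h1, h2, a1, a2, H1⟩ := hρ.growth_large
  obtain ⟨c₃, c₄, α₃, α₄, h3, h4, a3, a4, H3⟩ := hρ.growth_small
  refine ⟨min c₁ c₃, R, by positivity, hR, fun w hw => ⟨?_, (H w hw.le).le⟩⟩
  rcases le_total 1 (ρ w) with h | h
  · have := (H1 w h).1
    rw [hw, Real.one_rpow, mul_one] at this
    exact (min_le_left _ _).trans this
  · have := (H3 w h).1
    rw [hw, Real.one_rpow, mul_one] at this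
    exact (min_le_right _ _).trans this

/-- The shell `{a ≤ ρ < b}`. -/
def shell (ρ : E n → ℝ) (a b : ℝ) : Set (E n) := {x | a ≤ ρ x ∧ ρ x < b}

theorem IsQuasiDistance.measurableSet_shell (hρ : IsQuasiDistance P ρ) (a b : ℝ) :
    MeasurableSet (shell ρ a b) :=
  (measurableSet_le measurable_const hρ.measurable).inter
    (measurableSet_lt hρ.measurable measurable_const)

-- As `D` is a union of orbits, its part in the shell lies in the image under `polarMap` of a
-- Euclidean cone over `D ∩ S^{n-1}`, cut to an annulus. The Jacobian is bounded on the annulus, and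
-- the volume of a cone is a multiple of the spherical measure of its base. Only an upper bound is
-- sought, so injectivity of `polarMap` plays no role.
open scoped Pointwise in
theorem IsQuasiDistance.volume_inter_shell_le (hρ : IsQuasiDistance P ρ) (hn : n ≠ 0) {a b : ℝ}
    (ha : 0 < a) (hb : 0 < b) :
    ∃ C : ℝ≥0, ∀ D : Set (E n), MeasurableSet D →
      (∀ t : ℝ, 0 < t → ∀ x, dilation P t x ∈ D ↔ x ∈ D) →
      volume (D ∩ shell ρ a b) ≤
        C * (volume : Measure (E n)).toSphere ((↑) ⁻¹' D : Set (Metric.sphere (0 : E n) 1)) := by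
  obtain ⟨m, M, hm, hM, hmM⟩ := hρ.exists_sphere_bounds
  obtain ⟨C, hC, hdet⟩ := exists_det_fderiv_polarMap_le P (div_pos ha hM) (b / m)
  refine ⟨(C * (2 * b / m) ^ n).toNNReal, fun D hD hinv => ?_⟩
  -- If `w = A_t x` lies on the sphere, then `1/t = ρ x / ρ w` belongs to `[a/M, b/m]`; the point
  -- `t⁻¹ • w` is the preimage of `x`.
  set U : Set (E n) := {y | a / M ≤ ‖y‖ ∧ ‖y‖ ≤ b / m ∧ ‖y‖⁻¹ • y ∈ D} with hU
  have hUm : MeasurableSet U :=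
    (measurableSet_le measurable_const measurable_norm).inter
      ((measurableSet_le measurable_norm measurable_const).inter
        ((measurable_norm.inv.smul measurable_id) hD))
  have hcover : D ∩ shell ρ a b ⊆ polarMap P '' U := by
    rintro x ⟨hxD, hxa, hxb⟩
    have hx0 : x ≠ 0 := by
      rintro rfl
      rw [hρ.map_zero] at hxa
      exact absurd hxa (not_le.2 ha)
    obtain ⟨t, ht, hw⟩ := hρ.exists_norm_dilation_eq_one hx0
    set w := dilation P t x with hwdef
    have hbd := hmM w hw
    have hρw : ρ w = t * ρ x := hρ.homogeneous t ht x
    have hnorm : ‖t⁻¹ • w‖ = t⁻¹ := by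
      rw [norm_smul, hw, mul_one, Real.norm_of_nonneg (by positivity)]
    have hdir : ‖t⁻¹ • w‖⁻¹ • (t⁻¹ • w) = w := by
      rw [hnorm, inv_inv, smul_smul, mul_inv_cancel₀ ht.ne', one_smul]
    refine ⟨t⁻¹ • w, ⟨?_, ?_, ?_⟩, ?_⟩
    · rw [hnorm, div_le_iff₀ hM, inv_mul_eq_div, le_div_iff₀ ht]
      calc a * t ≤ ρ x * t := by gcongr
        _ = ρ w := by rw [hρw, mul_comm]
        _ ≤ M := hbd.2
    · rw [hnorm, le_div_iff₀ hm, inv_mul_eq_div, div_le_iff₀ ht]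
      calc m ≤ ρ w := hbd.1
        _ = ρ x * t := by rw [hρw, mul_comm]
        _ ≤ b * t := by gcongr
    · rw [hdir, hwdef, hinv t ht]
      exact hxD
    · rw [polarMap, hdir, hnorm, hwdef, dilation_dilation P (inv_pos.2 ht) ht,
        inv_mul_cancel₀ ht.ne', dilation_one]
  have hpos : ∀ y ∈ U, y ≠ 0 := fun y hy => norm_pos_iff.1 ((div_pos ha hM).trans_le hy.1)
  have h1 : volume (polarMap P '' U) ≤ ENNReal.ofReal C * volume U := by
    refine (addHaar_image_le_lintegral_abs_det_fderiv volume hUm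
      (f' := fderiv ℝ (polarMap P)) fun y hy => ?_).trans ?_
    · exact (((contDiffOn_polarMap P).contDiffAt
        (isOpen_compl_singleton.mem_nhds (hpos y hy))).differentiableAt
        one_ne_zero).hasFDerivAt.hasFDerivWithinAt
    · rw [← setLIntegral_const]
      exact setLIntegral_mono measurable_const fun y hy =>
        ENNReal.ofReal_le_ofReal (hdet y hy.1 hy.2.1)
  set S : Set (Metric.sphere (0 : E n) 1) := (↑) ⁻¹' D with hS
  have hSm : MeasurableSet S := measurable_subtype_coe hD
  -- The cone defining the spherical measure has radii in the open interval `(0,1)`; the factor `2`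
  -- makes the rescaled norms strictly less than `1`.
  have h2 : U ⊆ (2 * b / m) • (Set.Ioo (0 : ℝ) 1 • ((↑) '' S : Set (E n))) := by
    intro y hy
    have hy0 : 0 < ‖y‖ := norm_pos_iff.2 (hpos y hy)
    have hbm : 0 < b / m := by positivity
    refine Set.mem_smul_set.2 ⟨(2 * b / m)⁻¹ • y, Set.mem_smul.2 ⟨(2 * b / m)⁻¹ * ‖y‖, ⟨?_, ?_⟩,
      ‖y‖⁻¹ • y, ⟨⟨‖y‖⁻¹ • y, ?_⟩, hy.2.2, rfl⟩, ?_⟩, ?_⟩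
    · positivity
    · rw [inv_mul_lt_iff₀ (by positivity), mul_one, mul_div_assoc]
      linarith [hy.2.1]
    · rw [mem_sphere_zero_iff_norm, norm_smul, norm_inv, norm_norm, inv_mul_cancel₀ hy0.ne']
    · rw [smul_smul, mul_assoc, mul_inv_cancel₀ hy0.ne', mul_one]
    · rw [smul_smul, mul_inv_cancel₀ (by positivity), one_smul]
  have h3 : volume U ≤ ENNReal.ofReal ((2 * b / m) ^ n) *
      (volume : Measure (E n)).toSphere S := by
    refine (measure_mono h2).trans ?_
    rw [Measure.addHaar_smul_of_nonneg _ (by positivity), finrank_euclideanSpace_fin,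
      Measure.toSphere_apply' _ hSm, finrank_euclideanSpace_fin]
    gcongr
    refine le_mul_of_one_le_left zero_le ?_
    exact_mod_cast Nat.one_le_iff_ne_zero.2 hn
  calc volume (D ∩ shell ρ a b) ≤ volume (polarMap P '' U) := measure_mono hcover
    _ ≤ ENNReal.ofReal C * (ENNReal.ofReal ((2 * b / m) ^ n) *
      (volume : Measure (E n)).toSphere S) := h1.trans (by gcongr)
    _ = _ := by
      rw [← mul_assoc, ← ENNReal.ofReal_mul hC]
      rfl

variable {s : ℝ≥0∞} {Ω : E n → ℝ}

/-- The sets `Ω⁻¹(A)` are dilation invariant, so `volume_inter_shell_le` says that the distribution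
of `Ω` on the shell is dominated by a multiple of its distribution on the sphere. Membership in
`L_s` depends only on the distribution, and this includes `s = ∞`. -/
theorem IsRoughKernel.memLp_shell (hΩ : IsRoughKernel P s Ω) (hρ : IsQuasiDistance P ρ)
    (hn : n ≠ 0) {a b : ℝ} (ha : 0 < a) (hb : 0 < b) :
    MemLp Ω s (volume.restrict (shell ρ a b)) := by
  obtain ⟨C, hC⟩ := hρ.volume_inter_shell_le hn ha hb
  have hmeas : Measurable fun w : Metric.sphere (0 : E n) 1 => Ω w :=
    hΩ.measurable.comp measurable_subtype_coe
  have hle : Measure.map Ω (volume.restrict (shell ρ a b)) ≤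
      (C : ℝ≥0∞) • Measure.map (fun w : Metric.sphere (0 : E n) 1 => Ω w)
        (volume : Measure (E n)).toSphere := by
    refine Measure.le_iff.2 fun A hA => ?_
    rw [Measure.map_apply hΩ.measurable hA, Measure.smul_apply, Measure.map_apply hmeas hA,
      Measure.restrict_apply (hΩ.measurable hA), smul_eq_mul]
    exact hC _ (hΩ.measurable hA) fun t ht x => by
      simp only [Set.mem_preimage, hΩ.homogeneous t ht]
  have h1 : MemLp (id : ℝ → ℝ) s (Measure.map (fun w : Metric.sphere (0 : E n) 1 => Ω w)
      (volume : Measure (E n)).toSphere) :=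
    (memLp_map_measure_iff aestronglyMeasurable_id hmeas.aemeasurable).2 hΩ.memLp_sphere
  have h2 := (h1.smul_measure (c := (C : ℝ≥0∞)) ENNReal.coe_ne_top).mono_measure hle
  exact (memLp_map_measure_iff aestronglyMeasurable_id hΩ.measurable.aemeasurable).1 h2

/-- The `L_s` norm of `Ω` over dilated shells. -/
theorem IsRoughKernel.eLpNorm_shell_le (hΩ : IsRoughKernel P s Ω) (hρ : IsQuasiDistance P ρ)
    (hn : n ≠ 0) {a b : ℝ} (ha : 0 < a) (hb : 0 < b) :
    ∃ C : ℝ, 0 ≤ C ∧ ∀ R : ℝ, 0 < R →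
      eLpNorm Ω s (volume.restrict (shell ρ (a * R) (b * R))) ≤
        ENNReal.ofReal (C * R ^ (P.trace * (s⁻¹).toReal)) := by
  have hmem := hΩ.memLp_shell hρ hn ha hb
  refine ⟨(eLpNorm Ω s (volume.restrict (shell ρ a b))).toReal, ENNReal.toReal_nonneg,
    fun R hR => ?_⟩
  have hpre : dilation P R ⁻¹' (shell ρ (a * R) (b * R)) = shell ρ a b := by
    ext x
    simp only [shell, Set.mem_preimage, Set.mem_ofPred_eq, hρ.homogeneous R hR, mul_comm R]
    rw [mul_le_mul_iff_left₀ hR, mul_lt_mul_iff_left₀ hR]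
  have hcomp : Ω ∘ dilation P R = Ω := funext fun x => hΩ.homogeneous R hR x
  have hdm := (continuous_dilation P R).measurable
  -- `A_R` carries the fixed shell to the dilated one and preserves `Ω`, so only the Jacobian
  -- remains. It enters with the power `1/s`, which `(s⁻¹).toReal` reads as `0` when `s = ∞`.
  have h1 : eLpNorm Ω s (volume.restrict (shell ρ a b)) =
      eLpNorm Ω s (ENNReal.ofReal (R ^ (-P.trace)) •
        volume.restrict (shell ρ (a * R) (b * R))) := by
    rw [← Measure.restrict_smul, ← map_dilation_volume P hR,
      Measure.restrict_map hdm (hρ.measurableSet_shell _ _), hpre,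
      eLpNorm_map_measure hΩ.measurable.aestronglyMeasurable hdm.aemeasurable, hcomp]
  have h0 : ENNReal.ofReal (R ^ (-P.trace)) ≠ 0 := by
    rw [Ne, ENNReal.ofReal_eq_zero, not_le]; positivity
  have h2 : eLpNorm Ω s (volume.restrict (shell ρ (a * R) (b * R))) =
      ENNReal.ofReal (R ^ (P.trace * (s⁻¹).toReal)) *
        eLpNorm Ω s (volume.restrict (shell ρ a b)) := by
    rw [h1, eLpNorm_smul_measure_of_ne_zero h0, smul_eq_mul, ← mul_assoc,
      ENNReal.ofReal_rpow_of_pos (by positivity), ← ENNReal.ofReal_mul (by positivity),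
      ← Real.rpow_mul hR.le, ← Real.rpow_add hR]
    simp
  rw [h2, mul_comm, ENNReal.ofReal_mul ENNReal.toReal_nonneg, ENNReal.ofReal_toReal hmem.2.ne]

end

/-! ### Integral estimates for the kernel -/

section

variable {n : ℕ} {P : Matrix (Fin n) (Fin n) ℝ} {ρ : E n → ℝ}

theorem enorm_rpow_lintegral_eq {α F : Type*} [MeasurableSpace α] [NormedAddCommGroup F]
    (μ : Measure α) {q : ℝ} (hq : 0 < q) (f : α → F) :
    ∫⁻ x, ‖f x‖ₑ ^ q ∂μ = eLpNorm f (ENNReal.ofReal q) μ ^ q := by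
  rw [eLpNorm_eq_lintegral_rpow_enorm_toReal (by simpa using hq) ENNReal.ofReal_ne_top,
    ENNReal.toReal_ofReal hq.le, ← ENNReal.rpow_mul, one_div_mul_cancel hq.ne', ENNReal.rpow_one]

theorem eLpNorm_eq_restrict_of_support {α F : Type*} [MeasurableSpace α] [NormedAddCommGroup F]
    {μ : Measure α} {S : Set α} (hS : MeasurableSet S) {g : α → F} (hg : ∀ y, g y ≠ 0 → y ∈ S)
    (a : ℝ≥0∞) : eLpNorm g a μ = eLpNorm g a (μ.restrict S) := by
  rw [← eLpNorm_indicator_eq_eLpNorm_restrict hS, Set.indicator_eq_self.2]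
  exact fun y hy => hg y hy

/-- Comparison of the `L_a` and `L_b` norms of a function supported in a set. -/
theorem eLpNorm_le_mul_rpow_of_support {α F : Type*} [MeasurableSpace α] [NormedAddCommGroup F]
    {μ : Measure α} {S : Set α} (hS : MeasurableSet S) {g : α → F} (hgm : AEStronglyMeasurable g μ)
    (hg : ∀ y, g y ≠ 0 → y ∈ S) {a b : ℝ≥0∞} (hab : a ≤ b) :
    eLpNorm g a μ ≤ eLpNorm g b μ * μ S ^ (1 / a.toReal - 1 / b.toReal) := by
  rw [eLpNorm_eq_restrict_of_support hS hg a, eLpNorm_eq_restrict_of_support hS hg b]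
  simpa using eLpNorm_le_eLpNorm_mul_rpow_measure_univ hab hgm.restrict

section Convolution

variable {F : Type*} [NormedAddCommGroup F] [NormedSpace ℝ F] {S B : Set (E n)} {s : ℝ≥0∞}
  {h : E n → ℝ} {g : E n → F}

theorem lintegral_enorm_mul_eq_eLpNorm_smul (x : E n) :
    ∫⁻ y, ‖h (x - y)‖ₑ * ‖g y‖ₑ = eLpNorm (fun y => h (x - y) • g y) 1 volume := by
  rw [eLpNorm_one_eq_lintegral_enorm]
  simp only [enorm_smul]

theorem eLpNorm_comp_sub_left (hh : Measurable h) (x : E n) :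
    eLpNorm (fun y => h (x - y)) s volume = eLpNorm h s volume :=
  eLpNorm_comp_measurePreserving hh.aestronglyMeasurable (Measure.measurePreserving_sub_left volume x)

theorem eLpNorm_comp_sub_right (hh : Measurable h) (y : E n) :
    eLpNorm (fun x => h (x - y)) s volume = eLpNorm h s volume :=
  eLpNorm_comp_measurePreserving hh.aestronglyMeasurable (measurePreserving_sub_right volume y)

/-- Hölder in `y` with exponents `s` and `s'` bounds the inner integral uniformly in `x`; `s' ≤ q`
then allows passing from `L_{s'}` to `L_q` on `S`, and the outer integral contributes only `|B|`. -/
theorem lintegral_conv_rpow_le_of_conjExponent_le (hs : 1 < s) {q : ℝ} (hq : 1 ≤ q)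
    (hsq : ENNReal.conjExponent s ≤ ENNReal.ofReal q) (hh : Measurable h) (hS : MeasurableSet S)
    (hg : AEStronglyMeasurable g volume) (hgS : ∀ y, g y ≠ 0 → y ∈ S) :
    ∫⁻ x in B, (∫⁻ y, ‖h (x - y)‖ₑ * ‖g y‖ₑ) ^ q ≤
      (eLpNorm h s volume * volume S ^ (1 - (s⁻¹).toReal - 1 / q) * volume B ^ (1 / q) *
        eLpNorm g (ENNReal.ofReal q) volume) ^ q := by
  have hq0 : 0 < q := by linarith
  have := ENNReal.HolderConjugate.conjExponent hs.le
  have hs' : 1 / (ENNReal.conjExponent s).toReal = 1 - (s⁻¹).toReal := by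
    have e := ENNReal.HolderConjugate.inv_add_inv_eq_one s (ENNReal.conjExponent s)
    have e' := congrArg ENNReal.toReal e
    have hsi : s⁻¹ ≠ ∞ := by simpa using (zero_lt_one.trans hs).ne'
    rw [ENNReal.toReal_add hsi (by
      intro h'
      rw [h'] at e
      simp at e), ENNReal.toReal_one] at e'
    rw [one_div, ← ENNReal.toReal_inv]
    linarith
  have hpt : ∀ x, ∫⁻ y, ‖h (x - y)‖ₑ * ‖g y‖ₑ ≤ eLpNorm h s volume *
      (eLpNorm g (ENNReal.ofReal q) volume * volume S ^ (1 - (s⁻¹).toReal - 1 / q)) := by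
    intro x
    rw [lintegral_enorm_mul_eq_eLpNorm_smul]
    have hhx : AEStronglyMeasurable (fun y => h (x - y)) volume :=
      (hh.comp (measurable_const.sub measurable_id)).aestronglyMeasurable
    refine (eLpNorm_smul_le_mul_eLpNorm (p := s) (q := ENNReal.conjExponent s) hg hhx).trans ?_
    rw [eLpNorm_comp_sub_left hh]
    gcongr
    refine (eLpNorm_le_mul_rpow_of_support hS hg hgS hsq).trans_eq ?_
    rw [hs', ENNReal.toReal_ofReal hq0.le]
  calc ∫⁻ x in B, (∫⁻ y, ‖h (x - y)‖ₑ * ‖g y‖ₑ) ^ q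
      ≤ ∫⁻ x in B, (eLpNorm h s volume * (eLpNorm g (ENNReal.ofReal q) volume *
          volume S ^ (1 - (s⁻¹).toReal - 1 / q))) ^ q := by
        refine lintegral_mono fun x => ?_
        gcongr
        exact hpt x
    _ = _ := by
        rw [setLIntegral_const]
        have : volume B = (volume B ^ (1 / q)) ^ q := by
          rw [← ENNReal.rpow_mul, one_div_mul_cancel hq0.ne', ENNReal.rpow_one]
        rw [this, ← ENNReal.mul_rpow_of_nonneg _ _ hq0.le, ← this]
        congr 1
        ring

/-- Hölder on `S` moves the power `q` inside the `y`-integral. After Tonelli the `L_s` norm of `h`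
is spent in the variable `x`, where `q ≤ s` leaves the power `1/q - 1/s` of `|B|`. -/
theorem lintegral_conv_rpow_le_of_le {q : ℝ} (hq : 1 ≤ q)
    (hsq : ENNReal.ofReal q ≤ s) (hh : Measurable h) (hS : MeasurableSet S)
    (hg : AEStronglyMeasurable g volume) (hgS : ∀ y, g y ≠ 0 → y ∈ S) :
    ∫⁻ x in B, (∫⁻ y, ‖h (x - y)‖ₑ * ‖g y‖ₑ) ^ q ≤
      (eLpNorm h s volume * volume S ^ (1 - 1 / q) * volume B ^ (1 / q - (s⁻¹).toReal) *
        eLpNorm g (ENNReal.ofReal q) volume) ^ q := by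
  have hq0 : 0 < q := by linarith
  have hpt : ∀ x, (∫⁻ y, ‖h (x - y)‖ₑ * ‖g y‖ₑ) ^ q ≤
      (∫⁻ y, ‖h (x - y)‖ₑ ^ q * ‖g y‖ₑ ^ q) * (volume S ^ (1 - 1 / q)) ^ q := by
    intro x
    rw [lintegral_enorm_mul_eq_eLpNorm_smul]
    have hhx : AEStronglyMeasurable (fun y => h (x - y) • g y) volume :=
      (hh.comp (measurable_const.sub measurable_id)).aestronglyMeasurable.smul hg
    have h1 := eLpNorm_le_mul_rpow_of_support hS hhx
      (fun y hy => hgS y fun h0 => hy (by simp [h0]))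
      (a := 1) (b := ENNReal.ofReal q) (by simpa using hq)
    rw [ENNReal.toReal_one, ENNReal.toReal_ofReal hq0.le, one_div_one] at h1
    refine (ENNReal.rpow_le_rpow h1 hq0.le).trans_eq ?_
    rw [ENNReal.mul_rpow_of_nonneg _ _ hq0.le, ← enorm_rpow_lintegral_eq _ hq0]
    simp only [enorm_smul, ENNReal.mul_rpow_of_nonneg _ _ hq0.le]
  have hmeas : AEMeasurable (Function.uncurry fun x y => ‖h (x - y)‖ₑ ^ q * ‖g y‖ₑ ^ q)
      ((volume.restrict B).prod volume) := by
    refine AEMeasurable.mul ?_ ?_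
    · exact ((hh.comp (measurable_fst.sub measurable_snd)).enorm.pow_const q).aemeasurable
    · exact (hg.enorm.pow_const q).comp_snd
  have hin : ∀ y, ∫⁻ x in B, ‖h (x - y)‖ₑ ^ q ≤
      (eLpNorm h s volume * volume B ^ (1 / q - (s⁻¹).toReal)) ^ q := by
    intro y
    rw [enorm_rpow_lintegral_eq _ hq0]
    gcongr
    have hhy : AEStronglyMeasurable (fun x => h (x - y)) (volume.restrict B) :=
      (hh.comp (measurable_id.sub measurable_const)).aestronglyMeasurable
    have h1 := eLpNorm_le_eLpNorm_mul_rpow_measure_univ hsq hhy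
    rw [Measure.restrict_apply_univ, ENNReal.toReal_ofReal hq0.le, one_div s.toReal,
      ← ENNReal.toReal_inv] at h1
    refine h1.trans ?_
    gcongr
    exact (eLpNorm_mono_measure _ Measure.restrict_le_self).trans_eq (eLpNorm_comp_sub_right hh y)
  calc ∫⁻ x in B, (∫⁻ y, ‖h (x - y)‖ₑ * ‖g y‖ₑ) ^ q
      ≤ ∫⁻ x in B, (∫⁻ y, ‖h (x - y)‖ₑ ^ q * ‖g y‖ₑ ^ q) * (volume S ^ (1 - 1 / q)) ^ q :=
        lintegral_mono hpt
    _ = (∫⁻ x in B, ∫⁻ y, ‖h (x - y)‖ₑ ^ q * ‖g y‖ₑ ^ q) * (volume S ^ (1 - 1 / q)) ^ q :=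
        lintegral_mul_const'' _ hmeas.lintegral_prod_right'
    _ = (∫⁻ y, (∫⁻ x in B, ‖h (x - y)‖ₑ ^ q) * ‖g y‖ₑ ^ q) * (volume S ^ (1 - 1 / q)) ^ q := by
        rw [lintegral_lintegral_swap hmeas]
        congr 1
        refine lintegral_congr fun y => ?_
        rw [lintegral_mul_const]
        exact (hh.comp (measurable_id.sub measurable_const)).enorm.pow_const q
    _ ≤ (∫⁻ y, (eLpNorm h s volume * volume B ^ (1 / q - (s⁻¹).toReal)) ^ q * ‖g y‖ₑ ^ q) *
        (volume S ^ (1 - 1 / q)) ^ q := by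
        gcongr with y
        exact hin y
    _ = _ := by
        rw [lintegral_const_mul'' _ (hg.enorm.pow_const q), enorm_rpow_lintegral_eq _ hq0,
          ← ENNReal.mul_rpow_of_nonneg _ _ hq0.le, ← ENNReal.mul_rpow_of_nonneg _ _ hq0.le]
        congr 1
        ring

end Convolution

/-- Here `A` stands for `1/s` and `e` for the exponent of the small ellipsoid's volume; all radii
combine into a power of `R / r`, uniformly in the two kernel estimates. -/
theorem rpow_scaling_identity {V R r γ κ c e A : ℝ} (hV : 0 < V) (hR : 0 < R) (hr : 0 < r)
    (hκ : 0 < κ) :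
    (R / κ) ^ (-γ) * ((c * R ^ (γ * A)) * (V * R ^ γ) ^ (1 - A - e) * (V * r ^ γ) ^ e) =
      (κ ^ γ * c * V ^ (1 - A)) * (R / r) ^ (-(γ * e)) := by
  rw [Real.div_rpow hR.le hκ.le, Real.div_rpow hR.le hr.le, Real.mul_rpow hV.le (by positivity),
    Real.mul_rpow hV.le (by positivity), ← Real.rpow_mul hR.le, ← Real.rpow_mul hr.le,
    Real.rpow_neg hκ.le, Real.rpow_neg hr.le, div_inv_eq_mul, div_inv_eq_mul]
  have e1 : V ^ (1 - A) = V ^ (1 - A - e) * V ^ e := by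
    rw [← Real.rpow_add hV]; congr 1; ring
  have e2 : R ^ (-(γ * e)) = R ^ (-γ) * (R ^ (γ * A) * R ^ (γ * (1 - A - e))) := by
    rw [← Real.rpow_add hR, ← Real.rpow_add hR]; congr 1; ring
  rw [e1, e2]
  ring

section Kernel

variable {F : Type*} [NormedAddCommGroup F] [NormedSpace ℝ F] {s : ℝ≥0∞} {Ω : E n → ℝ}

/-- The two admissible relations between the integrability of the kernel and the exponent `q`,
together with the resulting loss `σ` in the decay. -/
def Admissible (P : Matrix (Fin n) (Fin n) ℝ) (s : ℝ≥0∞) (q σ : ℝ) : Prop :=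
  (ENNReal.conjExponent s ≤ ENNReal.ofReal q ∧ σ = 0) ∨
    (ENNReal.ofReal q ≤ s ∧ σ = P.trace * (s⁻¹).toReal)

/-- For `x` in `E(x₀,r)` and `y` in the support of `g`, the quasi-triangle inequality with `R ≥ 4 k
r` puts `x - y` in one shell of size comparable to `R`. There `ρ^{-γ}` is at most a constant times
`R^{-γ}`, and `Ω` may be cut off to the shell, where its `L_s` norm is known. -/
theorem lintegral_kernel_rpow_le (hρ : IsQuasiDistance P ρ) (hΩ : IsRoughKernel P s Ω)
    (hn : n ≠ 0) (hs : 1 < s) {q σ : ℝ} (hq : 1 ≤ q) (hadm : Admissible P s q σ) {k : ℝ}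
    (hk : 1 ≤ k) (htri : ∀ x y, ρ (x + y) ≤ k * (ρ x + ρ y)) :
    ∃ C : ℝ, 0 ≤ C ∧ ∀ (x₀ : E n) (r R : ℝ), 0 < r → 4 * k * r ≤ R → ∀ g : E n → F,
      AEStronglyMeasurable g volume →
      (∀ y, g y ≠ 0 → R / 2 ≤ ρ (x₀ - y) ∧ ρ (x₀ - y) < R) →
      ∫⁻ x in ellipsoid ρ x₀ r,
        (∫⁻ y, ENNReal.ofReal (|Ω (x - y)| / ρ (x - y) ^ P.trace) * ‖g y‖ₑ) ^ q ≤
      (ENNReal.ofReal (C * (R / r) ^ (σ - P.trace / q)) *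
        eLpNorm g (ENNReal.ofReal q) volume) ^ q := by
  have hq0 : 0 < q := by linarith
  have hk0 : 0 < k := by linarith
  have hV := hρ.unitVolume_pos
  have hγ := hρ.trace_nonneg
  obtain ⟨c, hc, hΩc⟩ := hΩ.eLpNorm_shell_le hρ hn (a := 1 / (4 * k)) (b := 2 * k)
    (by positivity) (by positivity)
  refine ⟨(4 * k) ^ P.trace * c * unitVolume ρ ^ (1 - (s⁻¹).toReal), by positivity,
    fun x₀ r R hr hR g hg hgS => ?_⟩
  have hR0 : 0 < R := lt_of_lt_of_le (by positivity) hR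
  set h : E n → ℝ := (shell ρ (1 / (4 * k) * R) (2 * k * R)).indicator Ω with hh_def
  have hshell := hρ.measurableSet_shell (1 / (4 * k) * R) (2 * k * R)
  have hh : Measurable h := hΩ.measurable.indicator hshell
  have hhn : eLpNorm h s volume ≤ ENNReal.ofReal (c * R ^ (P.trace * (s⁻¹).toReal)) := by
    rw [hh_def, eLpNorm_indicator_eq_eLpNorm_restrict hshell]
    exact hΩc R hR0
  have hpt : ∀ x ∈ ellipsoid ρ x₀ r,
      ∫⁻ y, ENNReal.ofReal (|Ω (x - y)| / ρ (x - y) ^ P.trace) * ‖g y‖ₑ ≤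
        ENNReal.ofReal ((R / (4 * k)) ^ (-P.trace)) * ∫⁻ y, ‖h (x - y)‖ₑ * ‖g y‖ₑ := by
    intro x hx
    rw [← lintegral_const_mul' _ _ ENNReal.ofReal_ne_top]
    refine lintegral_mono fun y => ?_
    by_cases hy : g y = 0
    · simp [hy]
    obtain ⟨hy1, hy2⟩ := hgS y hy
    have hx' : ρ (x₀ - x) < r := hx
    have hlow : 1 / (4 * k) * R ≤ ρ (x - y) := by
      have h1 := htri (x₀ - x) (x - y)
      rw [sub_add_sub_cancel] at h1
      have h2 : R / 2 ≤ k * r + k * ρ (x - y) := by nlinarith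
      have h3 : R / 4 ≤ k * ρ (x - y) := by linarith
      rw [one_div_mul_eq_div, div_le_iff₀ (by positivity)]
      linarith
    have hup : ρ (x - y) < 2 * k * R := by
      have h1 := htri (x - x₀) (x₀ - y)
      rw [sub_add_sub_cancel, hρ.symm x x₀] at h1
      have h2 : ρ (x₀ - x) + ρ (x₀ - y) < 2 * R := by nlinarith
      nlinarith
    have hhx : h (x - y) = Ω (x - y) := 
      Set.indicator_of_mem (show x - y ∈ shell ρ _ _ from ⟨hlow, hup⟩) _
    rw [hhx, ← mul_assoc, Real.enorm_eq_ofReal_abs, ← ENNReal.ofReal_mul (by positivity)]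
    gcongr
    rw [div_eq_mul_inv, mul_comm, Real.rpow_neg (by positivity)]
    gcongr
    rw [div_eq_mul_one_div, mul_comm]
    exact hlow
  have hSm := hρ.measurableSet_ellipsoid x₀ R
  have hgS' : ∀ y, g y ≠ 0 → y ∈ ellipsoid ρ x₀ R := fun y hy => (hgS y hy).2
  -- The exponent `e` of `|E(x₀,r)|` is `1/q` in the Hölder case and `1/q - 1/s` in the Tonelli
  -- case; the difference is the loss `σ`.
  obtain ⟨e, he, hconv⟩ : ∃ e : ℝ, σ - P.trace / q = -(P.trace * e) ∧
      ∫⁻ x in ellipsoid ρ x₀ r, (∫⁻ y, ‖h (x - y)‖ₑ * ‖g y‖ₑ) ^ q ≤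
      (eLpNorm h s volume * volume (ellipsoid ρ x₀ R) ^ (1 - (s⁻¹).toReal - e) *
        volume (ellipsoid ρ x₀ r) ^ e * eLpNorm g (ENNReal.ofReal q) volume) ^ q := by
    rcases hadm with ⟨h1, h2⟩ | ⟨h1, h2⟩
    · refine ⟨1 / q, by rw [h2]; ring, ?_⟩
      exact lintegral_conv_rpow_le_of_conjExponent_le hs hq h1 hh hSm hg hgS'
    · refine ⟨1 / q - (s⁻¹).toReal, by rw [h2]; ring, ?_⟩
      refine (lintegral_conv_rpow_le_of_le hq h1 hh hSm hg hgS').trans_eq ?_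
      congr 5
      ring
  have hcB : MeasurableSet (ellipsoid ρ x₀ r) := hρ.measurableSet_ellipsoid x₀ r
  calc ∫⁻ x in ellipsoid ρ x₀ r,
        (∫⁻ y, ENNReal.ofReal (|Ω (x - y)| / ρ (x - y) ^ P.trace) * ‖g y‖ₑ) ^ q
      ≤ ∫⁻ x in ellipsoid ρ x₀ r, ENNReal.ofReal ((R / (4 * k)) ^ (-P.trace)) ^ q *
          (∫⁻ y, ‖h (x - y)‖ₑ * ‖g y‖ₑ) ^ q := by
        refine setLIntegral_mono' hcB fun x hx => ?_
        rw [← ENNReal.mul_rpow_of_nonneg _ _ hq0.le]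
        exact ENNReal.rpow_le_rpow (hpt x hx) hq0.le
    _ = ENNReal.ofReal ((R / (4 * k)) ^ (-P.trace)) ^ q *
          ∫⁻ x in ellipsoid ρ x₀ r, (∫⁻ y, ‖h (x - y)‖ₑ * ‖g y‖ₑ) ^ q :=
        lintegral_const_mul' _ _ (ENNReal.rpow_ne_top_of_nonneg hq0.le ENNReal.ofReal_ne_top)
    _ ≤ ENNReal.ofReal ((R / (4 * k)) ^ (-P.trace)) ^ q *
          (ENNReal.ofReal (c * R ^ (P.trace * (s⁻¹).toReal)) *
            volume (ellipsoid ρ x₀ R) ^ (1 - (s⁻¹).toReal - e) *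
            volume (ellipsoid ρ x₀ r) ^ e * eLpNorm g (ENNReal.ofReal q) volume) ^ q := by
        refine mul_le_mul_right (hconv.trans ?_) _
        gcongr
    _ = _ := by
        rw [← ENNReal.mul_rpow_of_nonneg _ _ hq0.le, ← mul_assoc, he,
          ← rpow_scaling_identity (A := (s⁻¹).toReal) hV hR0 hr (by positivity),
          hρ.volume_ellipsoid x₀ hR0, hρ.volume_ellipsoid x₀ hr,
          ENNReal.ofReal_rpow_of_pos (by positivity), ENNReal.ofReal_rpow_of_pos (by positivity),
          ENNReal.ofReal_mul (p := (R / (4 * k)) ^ (-P.trace)) (by positivity),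
          ENNReal.ofReal_mul (q := (unitVolume ρ * r ^ P.trace) ^ e) (by positivity),
          ENNReal.ofReal_mul (p := c * R ^ (P.trace * (s⁻¹).toReal)) (by positivity)]

end Kernel

end

/-! ### Dyadic control of `T` and its extension by local limits -/

section

variable {n : ℕ} {P : Matrix (Fin n) (Fin n) ℝ} {ρ : E n → ℝ}

theorem indicator_eq_add_diff {α F : Type*} [AddZeroClass F] {A B : Set α} (h : A ⊆ B)
    (g : α → F) : B.indicator g = A.indicator g + (B \ A).indicator g := by
  have := Set.indicator_union_of_disjoint (Set.disjoint_sdiff_right (s := A) (t := B)) g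
  rwa [Set.union_sdiff_cancel h] at this

section LocalLimits

variable {𝕜 : Type*} [NormedAddCommGroup 𝕜] {α : Type*} [MeasurableSpace α]

theorem exists_tendsto_eLpNorm_of_cauchy [CompleteSpace 𝕜] {μ : Measure α} {F : ℝ → α → 𝕜}
    (hF : ∀ R, MemLp (F R) 1 μ) {b : ℝ → ℝ≥0∞} (hb : ∀ R, b R ≠ ∞)
    (hb0 : Tendsto b atTop (𝓝 0))
    (hFb : ∀ R R', R ≤ R' → eLpNorm (F R - F R') 1 μ ≤ b R) :
    ∃ g, MemLp g 1 μ ∧ Tendsto (fun R => eLpNorm (F R - g) 1 μ) atTop (𝓝 0) := by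
  have hc : CauchySeq fun R => (hF R).toLp (F R) := by
    refine cauchySeq_of_le_tendsto_0' (fun R => (b R).toReal) (fun R R' h => ?_) ?_
    · rw [dist_edist, Lp.edist_toLp_toLp]
      exact ENNReal.toReal_mono (hb R) (hFb R R' h)
    · exact (ENNReal.tendsto_toReal ENNReal.zero_ne_top).comp hb0
  obtain ⟨g, hg⟩ := cauchySeq_tendsto_of_complete hc
  refine ⟨g, Lp.memLp g, ?_⟩
  rw [← Lp.toLp_coeFn g (Lp.memLp g)] at hg
  exact (Lp.tendsto_Lp_iff_tendsto_eLpNorm'' F hF g (Lp.memLp g)).1 hg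

theorem ae_eq_of_tendsto_eLpNorm {μ : Measure α} {ι : Type*} {l : Filter ι} [l.NeBot]
    {F : ι → α → 𝕜} {g h : α → 𝕜}
    (hF : ∀ R, AEStronglyMeasurable (F R) μ) (hg : AEStronglyMeasurable g μ)
    (hh : AEStronglyMeasurable h μ) (h1 : Tendsto (fun R => eLpNorm (F R - g) 1 μ) l (𝓝 0))
    (h2 : Tendsto (fun R => eLpNorm (F R - h) 1 μ) l (𝓝 0)) : g =ᵐ[μ] h := by
  have hle : ∀ R, eLpNorm (g - h) 1 μ ≤ eLpNorm (F R - g) 1 μ + eLpNorm (F R - h) 1 μ := by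
    intro R
    have e : g - h = (F R - h) - (F R - g) := by abel
    rw [e, add_comm]
    exact eLpNorm_sub_le ((hF R).sub hh) ((hF R).sub hg) le_rfl
  have h0 : eLpNorm (g - h) 1 μ ≤ 0 := by
    have := h1.add h2
    rw [add_zero] at this
    exact ge_of_tendsto' this hle
  have := (eLpNorm_eq_zero_iff (hg.sub hh) one_ne_zero).1 (le_antisymm h0 zero_le)
  filter_upwards [this] with x hx
  exact sub_eq_zero.1 hx

/-- Limits on an exhausting sequence of sets can be glued. -/
theorem exists_glued_limit {μ : Measure α} {ι : Type*} {l : Filter ι} [l.NeBot]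
    {F : ι → α → 𝕜} {S : ℕ → Set α} (hS : Monotone S) (hSm : ∀ m, MeasurableSet (S m))
    (hSu : ⋃ m, S m = Set.univ)
    (hF : ∀ R m, AEStronglyMeasurable (F R) (μ.restrict (S m)))
    (hlim : ∀ m, ∃ g, AEStronglyMeasurable g (μ.restrict (S m)) ∧
      Tendsto (fun R => eLpNorm (F R - g) 1 (μ.restrict (S m))) l (𝓝 0)) :
    ∃ g, AEStronglyMeasurable g μ ∧
      ∀ m, Tendsto (fun R => eLpNorm (F R - g) 1 (μ.restrict (S m))) l (𝓝 0) := by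
  classical
  choose g hg hgl using hlim
  have hmem : ∀ x, ∃ m, x ∈ S m := fun x => by
    have : x ∈ ⋃ m, S m := hSu ▸ Set.mem_univ x
    simpa using this
  have hcompat : ∀ j m, j ≤ m → g j =ᵐ[μ.restrict (S j)] g m := by
    intro j m hjm
    have hle : μ.restrict (S j) ≤ μ.restrict (S m) := Measure.restrict_mono_set μ (hS hjm)
    refine ae_eq_of_tendsto_eLpNorm (fun R => hF R j) (hg j) ((hg m).mono_measure hle) (hgl j) ?_
    exact tendsto_of_tendsto_of_tendsto_of_le_of_le tendsto_const_nhds (hgl m)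
      (fun _ => zero_le) fun R => eLpNorm_mono_measure _ hle
  -- At each point the limit from the first set containing it is used; compatibility makes this
  -- agree almost everywhere with `g m` on all of `S m`.
  let G : α → 𝕜 := fun x => g (Nat.find (hmem x)) x
  have hG : ∀ m, G =ᵐ[μ.restrict (S m)] g m := by
    intro m
    have h1 : ∀ᵐ x ∂μ, ∀ j, j ≤ m → x ∈ S j → g j x = g m x :=
      ae_all_iff.2 fun j => by
        by_cases hjm : j ≤ m
        · filter_upwards [(ae_restrict_iff' (hSm j)).1 (hcompat j m hjm)] with x hx _ using hx
        · exact Eventually.of_forall fun x h => absurd h hjm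
    rw [EventuallyEq, ae_restrict_iff' (hSm m)]
    filter_upwards [h1] with x hx hxm
    exact hx _ (Nat.find_min' (hmem x) hxm) (Nat.find_spec (hmem x))
  refine ⟨G, ?_, fun m => ?_⟩
  · rw [← Measure.restrict_univ (μ := μ), ← hSu]
    exact aestronglyMeasurable_iUnion_iff.2 fun m => (hg m).congr (hG m).symm
  · refine (hgl m).congr fun R => eLpNorm_congr_ae ?_
    filter_upwards [hG m] with x hx
    simp [hx]

end LocalLimits

section Operator

variable {𝕜 : Type*} [RCLike 𝕜] {s : ℝ≥0∞} {Ω : E n → ℝ} {T : (E n → 𝕜) → (E n → 𝕜)}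

theorem MemLpLoc.indicator {f : E n → 𝕜} {a : ℝ≥0∞} (hf : MemLpLoc f a) {S : Set (E n)}
    (hS : MeasurableSet S) (hSb : Bornology.IsBounded S) : MemLp (S.indicator f) a volume := by
  rw [memLp_indicator_iff_restrict hS]
  exact (hf _ hSb.isCompact_closure).mono_measure (Measure.restrict_mono_set _ subset_closure)

theorem MemLpLoc.restrict {f : E n → 𝕜} {a : ℝ≥0∞} (hf : MemLpLoc f a) {S : Set (E n)}
    (hSb : Bornology.IsBounded S) : MemLp f a (volume.restrict S) :=
  (hf _ hSb.isCompact_closure).mono_measure (Measure.restrict_mono_set _ subset_closure)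

theorem MemLpLoc.aestronglyMeasurable {f : E n → 𝕜} {a : ℝ≥0∞} (hf : MemLpLoc f a) :
    AEStronglyMeasurable f volume := by
  have hu : ⋃ m : ℕ, Metric.closedBall (0 : E n) m = Set.univ := by
    rw [Set.iUnion_eq_univ_iff]
    intro x
    obtain ⟨m, hm⟩ := exists_nat_ge ‖x‖
    exact ⟨m, by simpa using hm⟩
  rw [← Measure.restrict_univ (μ := volume), ← hu]
  exact aestronglyMeasurable_iUnion_iff.2 fun m => (hf _ (isCompact_closedBall _ _)).1

theorem exists_eLpNorm_shell_le (hρ : IsQuasiDistance P ρ) (hΩ : IsRoughKernel P s Ω)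
    (hn : n ≠ 0) (hs : 1 < s) (hsize : SizeCondition P ρ Ω T) {q σ : ℝ} (hq : 1 < q)
    (hadm : Admissible P s q σ) {k : ℝ}
    (hk : 1 ≤ k) (htri : ∀ x y, ρ (x + y) ≤ k * (ρ x + ρ y)) :
    ∃ C : ℝ, 0 ≤ C ∧ ∀ (x₀ : E n) (r R : ℝ), 0 < r → 4 * k * r ≤ R → ∀ g : E n → 𝕜,
      MemLp g (ENNReal.ofReal q) volume →
      (∀ y, g y ≠ 0 → R / 2 ≤ ρ (x₀ - y) ∧ ρ (x₀ - y) < R) →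
      eLpNorm (T g) (ENNReal.ofReal q) (volume.restrict (ellipsoid ρ x₀ r)) ≤
      ENNReal.ofReal (C * (R / r) ^ (σ - P.trace / q)) *
        eLpNorm g (ENNReal.ofReal q) volume := by
  have hq0 : 0 < q := by linarith
  obtain ⟨C, hC, H⟩ := lintegral_kernel_rpow_le (F := 𝕜) hρ hΩ hn hs hq.le hadm hk htri
  obtain ⟨c₀, hc₀⟩ := hsize
  refine ⟨c₀ * C, by positivity, fun x₀ r R hr hR g hg hgS => ?_⟩
  have hsub : Function.support g ⊆ ellipsoid ρ x₀ R := fun y hy => (hgS y hy).2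
  have hbdd : Bornology.IsBounded (Function.support g) := (hρ.isBounded_ellipsoid x₀ R).subset hsub
  have hcs : HasCompactSupport g := hbdd.isCompact_closure
  have hint : Integrable g volume := memLp_one_iff_integrable.1
    (hg.mono_exponent_of_measure_support_ne_top (s := ellipsoid ρ x₀ R)
      (fun y hy => by
        by_contra h
        exact hy (hsub h))
      (hρ.volume_ellipsoid_ne_top _ _) (by simpa using hq.le))
  have hae := hc₀ g hcs hint
    ⟨ENNReal.ofReal q, by simpa using hq, ENNReal.ofReal_lt_top, hg⟩
  -- The size condition requires avoiding the closed support. On the neighbourhood `E(x,r)` of `x`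
  -- the quasi-triangle inequality gives `ρ (x₀ - y) < 2 k r ≤ R / 2`, so `g` vanishes there.
  have hnot : ∀ x ∈ ellipsoid ρ x₀ r, x ∉ tsupport g := by
    intro x hx
    rw [notMem_tsupport_iff_eventuallyEq]
    have hnhds : ellipsoid ρ x r ∈ 𝓝 x := by
      have h0 := hρ.ellipsoid_zero_mem_nhds hr
      have hc : Tendsto (fun y => y - x) (𝓝 x) (𝓝 0) := by
        have : Continuous fun y : E n => y - x := continuous_id.sub continuous_const
        simpa using this.tendsto x
      filter_upwards [hc h0] with y hy
      simpa [mem_ellipsoid] using hy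
    filter_upwards [hnhds] with y hy
    by_contra hy0
    have h1 := htri (x₀ - x) (x - y)
    rw [sub_add_sub_cancel] at h1
    have h2 := (hgS y hy0).1
    rw [mem_ellipsoid] at hx hy
    nlinarith
  have h1 : eLpNorm (T g) (ENNReal.ofReal q) (volume.restrict (ellipsoid ρ x₀ r)) ^ q ≤
      (ENNReal.ofReal (c₀ * C * (R / r) ^ (σ - P.trace / q)) *
        eLpNorm g (ENNReal.ofReal q) volume) ^ q := by
    rw [← enorm_rpow_lintegral_eq _ hq0]
    calc ∫⁻ x in ellipsoid ρ x₀ r, ‖T g x‖ₑ ^ q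
        ≤ ∫⁻ x in ellipsoid ρ x₀ r, (c₀ : ℝ≥0∞) ^ q *
          (∫⁻ y, ENNReal.ofReal (|Ω (x - y)| / ρ (x - y) ^ P.trace) * ‖g y‖ₑ) ^ q := by
          refine lintegral_mono_ae ?_
          rw [ae_restrict_iff' (hρ.measurableSet_ellipsoid x₀ r)]
          filter_upwards [hae] with x hx hxB
          rw [← ENNReal.mul_rpow_of_nonneg _ _ hq0.le]
          exact ENNReal.rpow_le_rpow (hx (hnot x hxB)) hq0.le
      _ = (c₀ : ℝ≥0∞) ^ q * ∫⁻ x in ellipsoid ρ x₀ r,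
          (∫⁻ y, ENNReal.ofReal (|Ω (x - y)| / ρ (x - y) ^ P.trace) * ‖g y‖ₑ) ^ q :=
          lintegral_const_mul' _ _ (ENNReal.rpow_ne_top_of_nonneg hq0.le ENNReal.coe_ne_top)
      _ ≤ (c₀ : ℝ≥0∞) ^ q * (ENNReal.ofReal (C * (R / r) ^ (σ - P.trace / q)) *
          eLpNorm g (ENNReal.ofReal q) volume) ^ q := by
          gcongr
          exact H x₀ r R hr hR g hg.1 hgS
      _ = _ := by
          rw [← ENNReal.mul_rpow_of_nonneg _ _ hq0.le, ← mul_assoc, mul_assoc (c₀ : ℝ),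
            ENNReal.ofReal_mul (p := (c₀ : ℝ)) c₀.2, ENNReal.ofReal_coe_nnreal]
  exact (ENNReal.rpow_le_rpow_iff hq0).1 h1

/-- The radii `4 k r 2^j`. -/
def radius (k r : ℝ) (j : ℕ) : ℝ := 4 * k * r * 2 ^ j

theorem radius_pos {k r : ℝ} (hk : 1 ≤ k) (hr : 0 < r) (j : ℕ) : 0 < radius k r j := by
  unfold radius; positivity

theorem radius_mono {k r : ℝ} (hk : 1 ≤ k) (hr : 0 < r) {i j : ℕ} (hij : i ≤ j) :
    radius k r i ≤ radius k r j := by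
  unfold radius
  gcongr
  exact one_le_two

theorem radius_succ (k r : ℝ) (j : ℕ) : radius k r (j + 1) = 2 * radius k r j := by
  unfold radius; ring

theorem tendsto_radius {k r : ℝ} (hk : 1 ≤ k) (hr : 0 < r) :
    Tendsto (radius k r) atTop atTop :=
  (tendsto_pow_atTop_atTop_of_one_lt one_lt_two).const_mul_atTop (by positivity)

/-- The dyadic sum which controls `T f` on `E(x₀, r)`. -/
def dyadicSum (ρ : E n → ℝ) (k : ℝ) (x₀ : E n) (q κ : ℝ) (r : ℝ) (f : E n → 𝕜) : ℝ≥0∞ :=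
  ∑' j : ℕ, ENNReal.ofReal (((2 : ℝ) ^ j) ^ κ) *
    eLpNorm f (ENNReal.ofReal q) (volume.restrict (ellipsoid ρ x₀ (radius k r j)))

/-- The part of `g` in `E(x₀, 4kr)` is handled by boundedness on `L_q`, the remaining shells by
`exists_eLpNorm_shell_le`. Bounded support makes the decomposition finite, so additivity suffices,
and the constant does not depend on the number of shells. -/
theorem exists_eLpNorm_le_dyadicSum (hρ : IsQuasiDistance P ρ) (hΩ : IsRoughKernel P s Ω)
    (hn : n ≠ 0) (hs : 1 < s) (hT : IsBoundedLinear T) (hsize : SizeCondition P ρ Ω T) {q σ : ℝ}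
    (hq : 1 < q) (hadm : Admissible P s q σ) {k : ℝ}
    (hk : 1 ≤ k) (htri : ∀ x y, ρ (x + y) ≤ k * (ρ x + ρ y)) :
    ∃ C : ℝ≥0, ∀ (x₀ : E n) (r : ℝ), 0 < r → ∀ g : E n → 𝕜,
      MemLp g (ENNReal.ofReal q) volume → Bornology.IsBounded (Function.support g) →
      eLpNorm (T g) (ENNReal.ofReal q) (volume.restrict (ellipsoid ρ x₀ r)) ≤
        C * dyadicSum ρ k x₀ q (σ - P.trace / q) r g := by
  have hq1 : 1 < ENNReal.ofReal q := by simpa using hq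
  have hqt : ENNReal.ofReal q < ∞ := ENNReal.ofReal_lt_top
  obtain ⟨C, hC, H⟩ := exists_eLpNorm_shell_le hρ hΩ hn hs hsize hq hadm hk htri
  obtain ⟨C', hC'⟩ := hT.bounded _ hq1 hqt
  set κ := σ - P.trace / q with hκ
  -- `C'` serves the core; the other entry serves the shells, where the ratio of radii is `4 k 2^j`.
  set D : ℝ≥0 := max C' (C * (4 * k) ^ κ).toNNReal with hD
  refine ⟨D, fun x₀ r hr g hg hgb => ?_⟩
  set a : ℕ → ℝ≥0∞ := fun j => ENNReal.ofReal (((2 : ℝ) ^ j) ^ κ) *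
    eLpNorm g (ENNReal.ofReal q) (volume.restrict (ellipsoid ρ x₀ (radius k r j))) with ha
  have hm : ∀ j, MeasurableSet (ellipsoid ρ x₀ (radius k r j)) :=
    fun j => hρ.measurableSet_ellipsoid _ _
  have key : ∀ N : ℕ, eLpNorm (T ((ellipsoid ρ x₀ (radius k r N)).indicator g)) (ENNReal.ofReal q)
      (volume.restrict (ellipsoid ρ x₀ r)) ≤ D * ∑ j ∈ Finset.range (N + 1), a j := by
    intro N
    induction N with
    | zero =>
      calc _ ≤ eLpNorm (T ((ellipsoid ρ x₀ (radius k r 0)).indicator g)) (ENNReal.ofReal q) volume :=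
            eLpNorm_mono_measure _ Measure.restrict_le_self
        _ ≤ C' * eLpNorm ((ellipsoid ρ x₀ (radius k r 0)).indicator g) (ENNReal.ofReal q) volume :=
            (hC' _ (hg.indicator (hm 0))).2
        _ ≤ _ := by
            rw [eLpNorm_indicator_eq_eLpNorm_restrict (hm 0)]
            simp only [zero_add, Finset.sum_range_one, ha, pow_zero, Real.one_rpow,
              ENNReal.ofReal_one, one_mul]
            gcongr
            exact le_max_left _ _
    | succ N ih =>
      set A := ellipsoid ρ x₀ (radius k r N)
      set B := ellipsoid ρ x₀ (radius k r (N + 1))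
      have hAB : A ⊆ B := ellipsoid_mono _ (radius_mono hk hr N.le_succ)
      have hdm : MeasurableSet (B \ A) := (hm _).diff (hm _)
      have hsplit : B.indicator g = A.indicator g + (B \ A).indicator g :=
        indicator_eq_add_diff hAB g
      have hA := hg.indicator (hm N)
      have hdiff := hg.indicator hdm
      have hshell : eLpNorm (T ((B \ A).indicator g)) (ENNReal.ofReal q)
          (volume.restrict (ellipsoid ρ x₀ r)) ≤ D * a (N + 1) := by
        refine (H x₀ r (radius k r (N + 1)) hr ?_ _ hdiff ?_).trans ?_
        · unfold radius
          exact le_mul_of_one_le_right (by positivity) (one_le_pow₀ one_le_two)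
        · intro y hy
          have hyd : y ∈ B \ A := Set.mem_of_indicator_ne_zero hy
          refine ⟨?_, hyd.1⟩
          rw [radius_succ, mul_div_cancel_left₀ _ two_ne_zero]
          exact not_lt.1 hyd.2
        · have e : C * (radius k r (N + 1) / r) ^ κ = C * (4 * k) ^ κ * ((2 : ℝ) ^ (N + 1)) ^ κ := by
            have : radius k r (N + 1) / r = 4 * k * 2 ^ (N + 1) := by
              unfold radius; field_simp
            rw [this, Real.mul_rpow (by positivity) (by positivity), mul_assoc]
          rw [e, ENNReal.ofReal_mul (by positivity), mul_assoc]
          have h1 : ENNReal.ofReal (C * (4 * k) ^ κ) ≤ (D : ℝ≥0∞) :=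
            ENNReal.coe_le_coe.2 (le_max_right _ _)
          have h2 : eLpNorm ((B \ A).indicator g) (ENNReal.ofReal q) volume ≤
              eLpNorm g (ENNReal.ofReal q) (volume.restrict B) := by
            rw [eLpNorm_indicator_eq_eLpNorm_restrict hdm]
            exact eLpNorm_mono_measure _ (Measure.restrict_mono_set _ Set.sdiff_subset)
          simp only [ha]
          gcongr
      rw [Finset.sum_range_succ, mul_add, hsplit,
        eLpNorm_congr_ae (ae_restrict_of_ae (hT.map_add _ hq1 hqt _ _ hA hdiff))]
      exact (eLpNorm_add_le (hC' _ hA).1.1.restrict (hC' _ hdiff).1.1.restrict hq1.le).trans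
        (add_le_add ih hshell)
  obtain ⟨R, hR, hsub⟩ := hρ.exists_subset_ellipsoid x₀ hgb
  obtain ⟨N, hN⟩ := ((tendsto_radius hk hr).eventually_ge_atTop R).exists
  have hgN : (ellipsoid ρ x₀ (radius k r N)).indicator g = g :=
    Set.indicator_eq_self.2 (hsub.trans (ellipsoid_mono _ hN))
  have := key N
  rw [hgN] at this
  refine this.trans ?_
  gcongr
  exact ENNReal.sum_le_tsum _

theorem dyadicSum_mono (k : ℝ) (x₀ : E n) (q κ r : ℝ) {f g : E n → 𝕜}
    (h : ∀ x, ‖f x‖ ≤ ‖g x‖) : dyadicSum ρ k x₀ q κ r f ≤ dyadicSum ρ k x₀ q κ r g := by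
  unfold dyadicSum
  gcongr with j
  exact eLpNorm_mono h

/-- The part of a dyadic sum that comes from the complement of a large ellipsoid is small. -/
theorem tendsto_dyadicSum_compl (hρ : IsQuasiDistance P ρ) {k : ℝ} {x₀ : E n}
    {q κ r : ℝ} {f : E n → 𝕜} (hf : dyadicSum ρ k x₀ q κ r f ≠ ∞) :
    Tendsto (fun R => dyadicSum ρ k x₀ q κ r ((ellipsoid ρ 0 R)ᶜ.indicator f)) atTop (𝓝 0) := by
  unfold dyadicSum at hf ⊢
  -- With the sum read as an integral for counting measure, dominated convergence applies: each term
  -- vanishes once `E(0,R)` contains the `j`-th ellipsoid.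
  simp_rw [← lintegral_count] at hf ⊢
  have := tendsto_lintegral_filter_of_dominated_convergence (μ := Measure.count) (l := atTop)
    (F := fun (R : ℝ) (j : ℕ) => ENNReal.ofReal (((2 : ℝ) ^ j) ^ κ) *
      eLpNorm ((ellipsoid ρ 0 R)ᶜ.indicator f) (ENNReal.ofReal q)
        (volume.restrict (ellipsoid ρ x₀ (radius k r j)))) (f := fun _ => 0)
    (fun j : ℕ => ENNReal.ofReal (((2 : ℝ) ^ j) ^ κ) *
      eLpNorm f (ENNReal.ofReal q) (volume.restrict (ellipsoid ρ x₀ (radius k r j))))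
    (Eventually.of_forall fun R => measurable_of_countable _)
    (Eventually.of_forall fun R => Eventually.of_forall fun j => by
      gcongr
      exact eLpNorm_indicator_le _) hf
    (Eventually.of_forall fun j => by
      obtain ⟨R₀, _, hR₀⟩ := hρ.exists_subset_ellipsoid 0
        (hρ.isBounded_ellipsoid x₀ (radius k r j))
      refine tendsto_const_nhds.congr' ?_
      filter_upwards [eventually_ge_atTop R₀] with R hR
      have hz : (ellipsoid ρ 0 R)ᶜ.indicator f
          =ᵐ[volume.restrict (ellipsoid ρ x₀ (radius k r j))] 0 := by
        rw [EventuallyEq, ae_restrict_iff' (hρ.measurableSet_ellipsoid _ _)]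
        refine Eventually.of_forall fun x hx => ?_
        exact Set.indicator_of_notMem
          (Set.notMem_compl_iff.2 (ellipsoid_mono 0 hR (hR₀ hx))) _
      rw [eLpNorm_congr_ae hz, eLpNorm_zero, mul_zero])
  simpa using this

theorem memLp_truncation (hρ : IsQuasiDistance P ρ) {a : ℝ≥0∞} {f : E n → 𝕜} (hf : MemLpLoc f a)
    (R : ℝ) : MemLp ((ellipsoid ρ 0 R).indicator f) a volume :=
  hf.indicator (hρ.measurableSet_ellipsoid 0 R) (hρ.isBounded_ellipsoid 0 R)

/-- The values at two truncations differ by `T` of `f` on `E(0,R') \ E(0,R)`, which is controlled by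
the dyadic sum of `f` off `E(0,R)`, a tail tending to `0`. Hence they are Cauchy in `L_1` of each
ellipsoid, and the limits are glued. -/
theorem exists_hasValue (hρ : IsQuasiDistance P ρ) (hT : IsBoundedLinear T) {q κ k : ℝ}
    (hq : 1 < q) (x₀ : E n) {C : ℝ≥0}
    (hTC : ∀ r : ℝ, 0 < r → ∀ g : E n → 𝕜,
      MemLp g (ENNReal.ofReal q) volume → Bornology.IsBounded (Function.support g) →
      eLpNorm (T g) (ENNReal.ofReal q) (volume.restrict (ellipsoid ρ x₀ r)) ≤
        C * dyadicSum ρ k x₀ q κ r g)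
    {f : E n → 𝕜} (hf : MemLpLoc f (ENNReal.ofReal q))
    (hsum : ∀ r : ℝ, 0 < r → dyadicSum ρ k x₀ q κ r f ≠ ∞) :
    ∃ g, HasValue ρ T f g := by
  have hq1 : 1 < ENNReal.ofReal q := by simpa using hq
  have hqt : ENNReal.ofReal q < ∞ := ENNReal.ofReal_lt_top
  obtain ⟨C', hC'⟩ := hT.bounded _ hq1 hqt
  have htr := fun R => memLp_truncation hρ hf R
  set F : ℝ → E n → 𝕜 := fun R => T ((ellipsoid ρ 0 R).indicator f) with hFdef
  have hFq : ∀ R, MemLp (F R) (ENNReal.ofReal q) volume := fun R => (hC' _ (htr R)).1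
  let S : ℕ → Set (E n) := fun m => ellipsoid ρ x₀ (m + 1)
  have hSm : ∀ m, MeasurableSet (S m) := fun m => hρ.measurableSet_ellipsoid _ _
  have hfin : ∀ m, IsFiniteMeasure (volume.restrict (S m)) := fun m =>
    isFiniteMeasure_restrict.2 (hρ.volume_ellipsoid_ne_top _ _)
  have hSmono : Monotone S := fun i j hij => ellipsoid_mono _ (by gcongr)
  have hSu : ⋃ m, S m = Set.univ := by
    rw [Set.iUnion_eq_univ_iff]
    intro x
    obtain ⟨m, hm⟩ := exists_nat_gt (ρ (x₀ - x))
    exact ⟨m, lt_trans hm (lt_add_one _)⟩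
  have hlim : ∀ m, ∃ g, AEStronglyMeasurable g (volume.restrict (S m)) ∧
      Tendsto (fun R => eLpNorm (F R - g) 1 (volume.restrict (S m))) atTop (𝓝 0) := by
    intro m
    have hr : (0 : ℝ) < m + 1 := by positivity
    have hfm := hfin m
    set v : ℝ≥0∞ := volume (S m) ^ (1 - 1 / q) with hv
    have hvt : v ≠ ∞ := ENNReal.rpow_ne_top_of_nonneg
      (by rw [sub_nonneg, div_le_one (by linarith)]; exact hq.le)
      (hρ.volume_ellipsoid_ne_top _ _)
    have hdlt : ∀ R, dyadicSum ρ k x₀ q κ (m + 1) ((ellipsoid ρ 0 R)ᶜ.indicator f) ≠ ∞ := fun R =>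
      ne_top_of_le_ne_top (hsum _ hr) (dyadicSum_mono k x₀ q κ _ fun x =>
        norm_indicator_le_norm_self _ _)
    obtain ⟨g, hg, hgl⟩ := exists_tendsto_eLpNorm_of_cauchy (μ := volume.restrict (S m)) (F := F)
      (b := fun R => C * v * dyadicSum ρ k x₀ q κ (m + 1) ((ellipsoid ρ 0 R)ᶜ.indicator f))
      (fun R => ((hFq R).restrict _).mono_exponent hq1.le)
      (fun R => ENNReal.mul_ne_top (ENNReal.mul_ne_top ENNReal.coe_ne_top hvt) (hdlt R))
      (by
        simpa using ENNReal.Tendsto.const_mul (tendsto_dyadicSum_compl hρ (hsum _ hr))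
          (Or.inr (ENNReal.mul_ne_top ENNReal.coe_ne_top hvt)))
      (fun R R' hRR' => by
        set d := (ellipsoid ρ 0 R' \ ellipsoid ρ 0 R).indicator f with hd
        have hdmem : MemLp d (ENNReal.ofReal q) volume :=
          hf.indicator ((hρ.measurableSet_ellipsoid _ _).diff (hρ.measurableSet_ellipsoid _ _))
            ((hρ.isBounded_ellipsoid 0 R').subset Set.sdiff_subset)
        have hsplit : (ellipsoid ρ 0 R').indicator f = (ellipsoid ρ 0 R).indicator f + d :=
          indicator_eq_add_diff (ellipsoid_mono 0 hRR') f
        have hadd := hT.map_add _ hq1 hqt _ _ (htr R) hdmem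
        rw [← hsplit] at hadd
        have hneg : F R - F R' =ᵐ[volume.restrict (S m)] -T d := by
          filter_upwards [ae_restrict_of_ae hadd] with x hx
          simp only [hFdef, Pi.sub_apply, Pi.neg_apply, hx, Pi.add_apply]
          ring
        rw [eLpNorm_congr_ae hneg, eLpNorm_neg]
        calc eLpNorm (T d) 1 (volume.restrict (S m))
            ≤ eLpNorm (T d) (ENNReal.ofReal q) (volume.restrict (S m)) * v := by
              refine (eLpNorm_le_eLpNorm_mul_rpow_measure_univ hq1.le
                (hC' _ hdmem).1.1.restrict).trans_eq ?_
              rw [Measure.restrict_apply_univ, ENNReal.toReal_one,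
                ENNReal.toReal_ofReal (by linarith), one_div_one]
          _ ≤ C * dyadicSum ρ k x₀ q κ (m + 1) d * v := by
              gcongr
              exact hTC _ hr d hdmem ((hρ.isBounded_ellipsoid 0 R').subset
                (Set.support_indicator_subset.trans Set.sdiff_subset))
          _ ≤ C * dyadicSum ρ k x₀ q κ (m + 1) ((ellipsoid ρ 0 R)ᶜ.indicator f) * v := by
              gcongr
              refine dyadicSum_mono k x₀ q κ _ fun x => ?_
              refine norm_indicator_le_of_subset (fun y hy => hy.2) _ _
          _ = _ := by ring)
    exact ⟨g, hg.1, hgl⟩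
  obtain ⟨g, hg, hgl⟩ := exists_glued_limit hSmono hSm hSu (fun R m => (hFq R).1.restrict) hlim
  refine ⟨g, hg, fun K hK => ?_⟩
  obtain ⟨r, hr, hsub⟩ := hρ.exists_subset_ellipsoid x₀ hK.isBounded
  obtain ⟨m, hm⟩ := exists_nat_gt r
  have hKS : K ⊆ S m := hsub.trans (ellipsoid_mono _ (by linarith))
  exact tendsto_of_tendsto_of_tendsto_of_le_of_le tendsto_const_nhds (hgl m)
    (fun _ => zero_le) fun R => eLpNorm_mono_measure _ (Measure.restrict_mono_set _ hKS)

end Operator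

end

section

variable {n : ℕ} {P : Matrix (Fin n) (Fin n) ℝ} {ρ : E n → ℝ} {𝕜 : Type*} [RCLike 𝕜]

/-! ### Averages and oscillation in local Campanato spaces -/

section Campanato

variable {b : E n → 𝕜} {x₀ : E n} {p₂ lam : ℝ}

theorem IsQuasiDistance.volume_ellipsoid_rpow (hρ : IsQuasiDistance P ρ) (x : E n) {r : ℝ}
    (hr : 0 < r) (e : ℝ) : volume (ellipsoid ρ x r) ^ e =
      ENNReal.ofReal (unitVolume ρ ^ e * r ^ (P.trace * e)) := by
  have hV := hρ.unitVolume_pos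
  rw [hρ.volume_ellipsoid x hr, ENNReal.ofReal_rpow_of_pos (by positivity),
    Real.mul_rpow hV.le (by positivity), ← Real.rpow_mul hr.le]

theorem IsQuasiDistance.volume_ellipsoid_ne_zero (hρ : IsQuasiDistance P ρ) (x : E n) {r : ℝ}
    (hr : 0 < r) : volume (ellipsoid ρ x r) ≠ 0 := by
  have hV := hρ.unitVolume_pos
  rw [hρ.volume_ellipsoid x hr, Ne, ENNReal.ofReal_eq_zero, not_le]
  positivity

theorem eLpNorm_sub_average_le (hρ : IsQuasiDistance P ρ) (hp₂ : 1 ≤ p₂) {R : ℝ} (hR : 0 < R) :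
    eLpNorm (fun y => b y - ⨍ z in ellipsoid ρ x₀ R, b z) (ENNReal.ofReal p₂)
      (volume.restrict (ellipsoid ρ x₀ R)) ≤
    volume (ellipsoid ρ x₀ R) ^ (1 / p₂ + lam) * campanatoNorm ρ x₀ p₂ lam b := by
  have hp0 : 0 < p₂ := by linarith
  set v := volume (ellipsoid ρ x₀ R) with hv
  have hv0 : v ≠ 0 := hρ.volume_ellipsoid_ne_zero x₀ hR
  have hvt : v ≠ ∞ := hρ.volume_ellipsoid_ne_top x₀ R
  have h : (v ^ (-(1 + lam * p₂)) * ∫⁻ y in ellipsoid ρ x₀ R,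
      ‖b y - ⨍ z in ellipsoid ρ x₀ R, b z‖ₑ ^ p₂) ^ (1 / p₂) ≤ campanatoNorm ρ x₀ p₂ lam b :=
    le_iSup₂_of_le (f := fun (r : ℝ) (_ : 0 < r) => (volume (ellipsoid ρ x₀ r) ^ (-(1 + lam * p₂)) *
      ∫⁻ y in ellipsoid ρ x₀ r, ‖b y - ⨍ z in ellipsoid ρ x₀ r, b z‖ₑ ^ p₂) ^ (1 / p₂)) R hR le_rfl
  rw [enorm_rpow_lintegral_eq _ hp0, ENNReal.mul_rpow_of_nonneg _ _ (by positivity),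
    ← ENNReal.rpow_mul, ← ENNReal.rpow_mul, mul_one_div_cancel hp0.ne', ENNReal.rpow_one] at h
  have e1 : -(1 + lam * p₂) * (1 / p₂) = -(1 / p₂ + lam) := by field_simp
  rw [e1] at h
  calc
    _ = v ^ (1 / p₂ + lam) * (v ^ (-(1 / p₂ + lam)) *
        eLpNorm (fun y => b y - ⨍ z in ellipsoid ρ x₀ R, b z) (ENNReal.ofReal p₂)
          (volume.restrict (ellipsoid ρ x₀ R))) := by
        rw [← mul_assoc, ← ENNReal.rpow_add _ _ hv0 hvt, add_neg_cancel, ENNReal.rpow_zero, one_mul]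
    _ ≤ _ := by gcongr

theorem enorm_average_sub_le (hρ : IsQuasiDistance P ρ) (hp₂ : 1 ≤ p₂)
    (hb : MemLpLoc b (ENNReal.ofReal p₂)) {R : ℝ} (hR : 0 < R) (c : 𝕜) :
    ‖(⨍ z in ellipsoid ρ x₀ R, b z) - c‖ₑ ≤ volume (ellipsoid ρ x₀ R) ^ (-(1 / p₂)) *
      eLpNorm (fun y => b y - c) (ENNReal.ofReal p₂) (volume.restrict (ellipsoid ρ x₀ R)) := by
  have hp0 : 0 < p₂ := by linarith
  set v := volume (ellipsoid ρ x₀ R) with hv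
  have hv0 : v ≠ 0 := hρ.volume_ellipsoid_ne_zero x₀ hR
  have hvt : v ≠ ∞ := hρ.volume_ellipsoid_ne_top x₀ R
  have hfin : IsFiniteMeasure (volume.restrict (ellipsoid ρ x₀ R)) :=
    isFiniteMeasure_restrict.2 hvt
  have hne : NeZero (volume.restrict (ellipsoid ρ x₀ R)) :=
    ⟨by rwa [Ne, Measure.restrict_eq_zero]⟩
  have hbR := hb.restrict (hρ.isBounded_ellipsoid x₀ R)
  have hbi : Integrable b (volume.restrict (ellipsoid ρ x₀ R)) :=
    hbR.integrable (by simpa using hp₂)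
  have e1 : (⨍ z in ellipsoid ρ x₀ R, b z) - c = ⨍ z in ellipsoid ρ x₀ R, (b z - c) := by
    simp only [average]
    rw [integral_sub (hbi.smul_measure (by
      simpa [ENNReal.inv_eq_top] using hv0)) (integrable_const _)]
    congr 1
    exact (average_const (volume.restrict (ellipsoid ρ x₀ R)) c).symm
  rw [e1]
  calc ‖⨍ z in ellipsoid ρ x₀ R, (b z - c)‖ₑ
      ≤ ∫⁻ z, ‖b z - c‖ₑ ∂((volume.restrict (ellipsoid ρ x₀ R) Set.univ)⁻¹ •
        volume.restrict (ellipsoid ρ x₀ R)) := enorm_integral_le_lintegral_enorm _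
    _ = v⁻¹ * eLpNorm (fun y => b y - c) 1 (volume.restrict (ellipsoid ρ x₀ R)) := by
        rw [lintegral_smul_measure, Measure.restrict_apply_univ, eLpNorm_one_eq_lintegral_enorm,
          smul_eq_mul]
    _ ≤ v⁻¹ * (eLpNorm (fun y => b y - c) (ENNReal.ofReal p₂)
        (volume.restrict (ellipsoid ρ x₀ R)) * v ^ (1 - 1 / p₂)) := by
        gcongr
        refine (eLpNorm_le_eLpNorm_mul_rpow_measure_univ (q := ENNReal.ofReal p₂)
          (by simpa using hp₂) (hbR.1.sub aestronglyMeasurable_const)).trans_eq ?_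
        rw [Measure.restrict_apply_univ, ENNReal.toReal_one, ENNReal.toReal_ofReal hp0.le,
          one_div_one]
        rfl
    _ = _ := by
        have : v ^ (-(1 / p₂)) = v⁻¹ * v ^ (1 - 1 / p₂) := by
          rw [← ENNReal.rpow_neg_one, ← ENNReal.rpow_add _ _ hv0 hvt]
          congr 1
          ring
        rw [this]
        ring

/-- Telescoping: by doubling, consecutive averages differ by at most a constant times `R^(γ lam)`
times the seminorm. Each of the `j` increments is bounded by the bound for the last one, so the
factor is `j`; this is the source of the logarithm. -/
theorem exists_enorm_average_sub_average_le (hρ : IsQuasiDistance P ρ) (hp₂ : 1 ≤ p₂)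
    (hlam : 0 ≤ lam) {k : ℝ} (hk : 1 ≤ k) :
    ∃ C : ℝ, 0 ≤ C ∧ ∀ (x₀ : E n) (b : E n → 𝕜), MemLpLoc b (ENNReal.ofReal p₂) →
      ∀ (r : ℝ), 0 < r → ∀ j : ℕ,
      ‖(⨍ z in ellipsoid ρ x₀ (radius k r j), b z) -
        ⨍ z in ellipsoid ρ x₀ (radius k r 0), b z‖ₑ ≤
      ENNReal.ofReal (C * j * radius k r j ^ (P.trace * lam)) * campanatoNorm ρ x₀ p₂ lam b := by
  have hV := hρ.unitVolume_pos
  have hγ := hρ.trace_nonneg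
  have hp0 : 0 < p₂ := by linarith
  set C := unitVolume ρ ^ lam * 2 ^ (P.trace * (1 / p₂)) with hC
  refine ⟨C, by positivity, fun x₀ b hb r hr j => ?_⟩
  induction j with
  | zero => simp
  | succ j ih =>
    set R := radius k r j with hRdef
    have hR : 0 < R := radius_pos hk hr j
    have hR2 : 0 < 2 * R := by positivity
    have hsucc : radius k r (j + 1) = 2 * R := radius_succ k r j
    have hstep : ‖(⨍ z in ellipsoid ρ x₀ R, b z) -
        ⨍ z in ellipsoid ρ x₀ (2 * R), b z‖ₑ ≤
        ENNReal.ofReal (C * (2 * R) ^ (P.trace * lam)) * campanatoNorm ρ x₀ p₂ lam b := by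
      refine (enorm_average_sub_le hρ hp₂ hb hR _).trans ?_
      calc _ ≤ volume (ellipsoid ρ x₀ R) ^ (-(1 / p₂)) *
            (volume (ellipsoid ρ x₀ (2 * R)) ^ (1 / p₂ + lam) * campanatoNorm ρ x₀ p₂ lam b) := by
            gcongr
            refine (eLpNorm_mono_measure _ (Measure.restrict_mono_set _
              (ellipsoid_mono x₀ (by linarith)))).trans
              (eLpNorm_sub_average_le hρ hp₂ hR2)
        _ = _ := by
            rw [← mul_assoc, hρ.volume_ellipsoid_rpow x₀ hR, hρ.volume_ellipsoid_rpow x₀ hR2,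
              ← ENNReal.ofReal_mul (by positivity)]
            congr 2
            rw [hC, Real.mul_rpow two_pos.le hR.le, Real.mul_rpow two_pos.le hR.le, mul_add,
              Real.rpow_add two_pos, Real.rpow_add hR, Real.rpow_add hV, mul_neg,
              Real.rpow_neg hV.le, Real.rpow_neg hR.le]
            have h1 := (Real.rpow_pos_of_pos hV (1 / p₂)).ne'
            have h2 := (Real.rpow_pos_of_pos hR (P.trace * (1 / p₂))).ne'
            field_simp
    rw [hsucc]
    set A := fun t : ℝ => ⨍ z in ellipsoid ρ x₀ t, b z
    have htri : A (2 * R) - A (radius k r 0) = (A R - A (radius k r 0)) - (A R - A (2 * R)) := by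
      ring
    calc ‖A (2 * R) - A (radius k r 0)‖ₑ
        ≤ ‖A R - A (radius k r 0)‖ₑ + ‖A R - A (2 * R)‖ₑ := by
          rw [htri]; exact enorm_sub_le
      _ ≤ ENNReal.ofReal (C * j * (2 * R) ^ (P.trace * lam)) * campanatoNorm ρ x₀ p₂ lam b +
          ENNReal.ofReal (C * (2 * R) ^ (P.trace * lam)) * campanatoNorm ρ x₀ p₂ lam b := by
          refine add_le_add (ih.trans ?_) hstep
          gcongr
          linarith
      _ = _ := by
          rw [← add_mul, ← ENNReal.ofReal_add (by positivity) (by positivity)]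
          congr 2
          push_cast
          ring

/-- Growth of the oscillation of a function in a local Campanato space over dyadic ellipsoids. -/
theorem exists_eLpNorm_sub_average_le (hρ : IsQuasiDistance P ρ) (hp₂ : 1 ≤ p₂)
    (hlam : 0 ≤ lam) {k : ℝ} (hk : 1 ≤ k) :
    ∃ C : ℝ, 0 ≤ C ∧ ∀ (x₀ : E n) (b : E n → 𝕜), MemLpLoc b (ENNReal.ofReal p₂) →
      ∀ (r : ℝ), 0 < r → ∀ j : ℕ,
      eLpNorm (fun y => b y - ⨍ z in ellipsoid ρ x₀ (radius k r 0), b z) (ENNReal.ofReal p₂)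
        (volume.restrict (ellipsoid ρ x₀ (radius k r j))) ≤
      ENNReal.ofReal (C * r ^ (P.trace * (1 / p₂ + lam))) * campanatoNorm ρ x₀ p₂ lam b *
        ENNReal.ofReal ((1 + j) * ((2 : ℝ) ^ j) ^ (P.trace * (1 / p₂ + lam))) := by
  have hV := hρ.unitVolume_pos
  have hp0 : 0 < p₂ := by linarith
  obtain ⟨C, hC, H⟩ := exists_enorm_average_sub_average_le (𝕜 := 𝕜) hρ hp₂ hlam hk
  set D := unitVolume ρ ^ (1 / p₂ + lam) + C * unitVolume ρ ^ (1 / p₂) with hD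
  have hD0 : 0 ≤ D := by positivity
  refine ⟨D * (4 * k) ^ (P.trace * (1 / p₂ + lam)), by positivity, fun x₀ b hb r hr j => ?_⟩
  set R := radius k r j with hRdef
  have hR : 0 < R := radius_pos hk hr j
  set N := campanatoNorm ρ x₀ p₂ lam b
  set β := ⨍ z in ellipsoid ρ x₀ (radius k r 0), b z
  set βR := ⨍ z in ellipsoid ρ x₀ R, b z
  set μ : Measure (E n) := volume.restrict (ellipsoid ρ x₀ R)
  have hbm : AEStronglyMeasurable (fun y => b y - βR) μ :=
    (hb.restrict (hρ.isBounded_ellipsoid x₀ R)).1.sub aestronglyMeasurable_const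
  have hconst : eLpNorm (fun _ : E n => βR - β) (ENNReal.ofReal p₂) μ =
      ‖βR - β‖ₑ * volume (ellipsoid ρ x₀ R) ^ (1 / p₂) := by
    rw [eLpNorm_const' _ (by simpa using hp0) ENNReal.ofReal_ne_top, Measure.restrict_apply_univ,
      ENNReal.toReal_ofReal hp0.le]
  -- The oscillation about the average over the current ellipsoid is separated from the drift of
  -- that average.
  have hsplit : (fun y => b y - β) = (fun y => b y - βR) + fun _ => βR - β := by
    funext y; simp
  calc eLpNorm (fun y => b y - β) (ENNReal.ofReal p₂) μ
      ≤ eLpNorm (fun y => b y - βR) (ENNReal.ofReal p₂) μ +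
        eLpNorm (fun _ : E n => βR - β) (ENNReal.ofReal p₂) μ := by
        rw [hsplit]
        exact eLpNorm_add_le hbm aestronglyMeasurable_const (by simpa using hp₂)
    _ ≤ ENNReal.ofReal (unitVolume ρ ^ (1 / p₂ + lam) * R ^ (P.trace * (1 / p₂ + lam))) * N +
        ENNReal.ofReal (C * j * R ^ (P.trace * lam)) * N *
          ENNReal.ofReal (unitVolume ρ ^ (1 / p₂) * R ^ (P.trace * (1 / p₂))) := by
        rw [hconst, ← hρ.volume_ellipsoid_rpow x₀ hR, ← hρ.volume_ellipsoid_rpow x₀ hR]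
        gcongr
        · exact eLpNorm_sub_average_le hρ hp₂ hR
        · exact H x₀ b hb r hr j
    _ = ENNReal.ofReal ((unitVolume ρ ^ (1 / p₂ + lam) + C * j * unitVolume ρ ^ (1 / p₂)) *
          R ^ (P.trace * (1 / p₂ + lam))) * N := by
        rw [mul_right_comm, ← ENNReal.ofReal_mul (by positivity), ← add_mul,
          ← ENNReal.ofReal_add (by positivity) (by positivity)]
        congr 2
        rw [mul_add P.trace, Real.rpow_add hR]
        ring
    _ ≤ ENNReal.ofReal ((D * (1 + j)) * R ^ (P.trace * (1 / p₂ + lam))) * N := by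
        gcongr
        have h1 : 0 ≤ unitVolume ρ ^ (1 / p₂ + lam) * j := by positivity
        have h2 : 0 ≤ C * unitVolume ρ ^ (1 / p₂) := by positivity
        rw [hD]
        nlinarith
    _ = _ := by
        rw [mul_right_comm (ENNReal.ofReal _) N, ← ENNReal.ofReal_mul (by positivity)]
        congr 2
        have : R = 4 * k * r * 2 ^ j := rfl
        rw [this, Real.mul_rpow (by positivity) (by positivity),
          Real.mul_rpow (by positivity) hr.le]
        ring

end Campanato

/-! ### Comparison of the weighted dyadic sum with the integral condition -/

section LogSum

/-- The dyadic counterpart of the integral with a logarithmic weight. -/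
def logSum (ρ : E n → ℝ) (k : ℝ) (x₀ : E n) (q κ : ℝ) (r : ℝ) (f : E n → 𝕜) : ℝ≥0∞ :=
  ∑' j : ℕ, ENNReal.ofReal ((1 + j) * ((2 : ℝ) ^ j) ^ κ) *
    eLpNorm f (ENNReal.ofReal q) (volume.restrict (ellipsoid ρ x₀ (radius k r j)))

theorem logSum_mono (k : ℝ) (x₀ : E n) (q κ r : ℝ) {f g : E n → 𝕜}
    (h : ∀ x, ‖f x‖ ≤ ‖g x‖) : logSum ρ k x₀ q κ r f ≤ logSum ρ k x₀ q κ r g := by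
  unfold logSum
  gcongr with j
  exact eLpNorm_mono h

theorem dyadicSum_le_logSum (k : ℝ) (x₀ : E n) (q r : ℝ) {κ κ' : ℝ} (h : κ ≤ κ') (f : E n → 𝕜) :
    dyadicSum ρ k x₀ q κ r f ≤ logSum ρ k x₀ q κ' r f := by
  unfold dyadicSum logSum
  gcongr with j
  have h1 : ((2 : ℝ) ^ j) ^ κ ≤ ((2 : ℝ) ^ j) ^ κ' :=
    Real.rpow_le_rpow_of_exponent_le (one_le_pow₀ one_le_two) h
  refine h1.trans (le_mul_of_one_le_left (by positivity) ?_)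
  linarith [(Nat.cast_nonneg j : (0 : ℝ) ≤ j)]

/-- The intervals between consecutive radii are disjoint, lie in `(r,∞)`, and have length equal to
their left endpoint. No measurability of `G` enters, so the essential infimum can be used as it
stands. -/
theorem tsum_mul_radius_le_lintegral {k r : ℝ} (hk : 1 ≤ k) (hr : 0 < r) {a : ℕ → ℝ≥0∞}
    {G : ℝ → ℝ≥0∞}
    (h : ∀ j : ℕ, ∀ t, radius k r j < t → t ≤ radius k r (j + 1) → a j ≤ G t) :
    ∑' j, a j * ENNReal.ofReal (radius k r j) ≤ ∫⁻ t in Set.Ioi r, G t := by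
  have hmono : Monotone (radius k r) := fun i j hij => radius_mono hk hr hij
  have hdisj := hmono.pairwise_disjoint_on_Ioc_succ
  have hsub : (⋃ j, Set.Ioc (radius k r j) (radius k r (j + 1))) ⊆ Set.Ioi r := by
    refine Set.iUnion_subset fun j t ht => ?_
    have h0 : radius k r 0 ≤ radius k r j := radius_mono hk hr (Nat.zero_le j)
    have h1 : r ≤ radius k r 0 := by
      unfold radius; rw [pow_zero, mul_one]; nlinarith
    exact lt_of_le_of_lt (h1.trans h0) ht.1
  calc ∑' j, a j * ENNReal.ofReal (radius k r j)
      ≤ ∑' j, ∫⁻ t in Set.Ioc (radius k r j) (radius k r (j + 1)), G t := by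
        gcongr with j
        have hvol : volume (Set.Ioc (radius k r j) (radius k r (j + 1))) =
            ENNReal.ofReal (radius k r j) := by
          rw [Real.volume_Ioc, radius_succ]; congr 1; ring
        rw [← hvol, ← setLIntegral_const]
        exact setLIntegral_mono' measurableSet_Ioc fun t ht => h j t ht.1 ht.2
    _ = ∫⁻ t in ⋃ j, Set.Ioc (radius k r j) (radius k r (j + 1)), G t :=
        (lintegral_iUnion (fun j => measurableSet_Ioc) hdisj G).symm
    _ ≤ _ := lintegral_mono_set hsub

theorem eLpNorm_le_mul_morreyNorm (hρ : IsQuasiDistance P ρ) {φ : E n → ℝ → ℝ}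
    (hφ : IsWeight φ) (x₀ : E n) (q : ℝ) (f : E n → 𝕜) {r : ℝ} (hr : 0 < r) :
    eLpNorm f (ENNReal.ofReal q) (volume.restrict (ellipsoid ρ x₀ r)) ≤
      ENNReal.ofReal (φ x₀ r) * volume (ellipsoid ρ x₀ r) ^ (1 / q) *
        morreyNorm ρ x₀ q φ f := by
  have hφ0 : ENNReal.ofReal (φ x₀ r) ≠ 0 := by
    simpa using hφ.2 x₀ r hr
  have hv0 := hρ.volume_ellipsoid_ne_zero x₀ hr
  have hvt := hρ.volume_ellipsoid_ne_top x₀ r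
  set v := volume (ellipsoid ρ x₀ r)
  have h : (ENNReal.ofReal (φ x₀ r))⁻¹ * v ^ (-(1 / q)) *
      eLpNorm f (ENNReal.ofReal q) (volume.restrict (ellipsoid ρ x₀ r)) ≤ morreyNorm ρ x₀ q φ f :=
    le_iSup₂_of_le (f := fun (r : ℝ) (_ : 0 < r) => (ENNReal.ofReal (φ x₀ r))⁻¹ *
      volume (ellipsoid ρ x₀ r) ^ (-(1 / q)) *
      eLpNorm f (ENNReal.ofReal q) (volume.restrict (ellipsoid ρ x₀ r))) r hr le_rfl
  refine le_trans (le_of_eq ?_) (mul_le_mul_right h _)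
  have e1 : v ^ (1 / q) * v ^ (-(1 / q)) = 1 := by
    rw [← ENNReal.rpow_add _ _ hv0 hvt, add_neg_cancel, ENNReal.rpow_zero]
  have e2 := ENNReal.mul_inv_cancel hφ0 ENNReal.ofReal_ne_top
  calc _ = (ENNReal.ofReal (φ x₀ r) * (ENNReal.ofReal (φ x₀ r))⁻¹) *
        (v ^ (1 / q) * v ^ (-(1 / q))) *
        eLpNorm f (ENNReal.ofReal q) (volume.restrict (ellipsoid ρ x₀ r)) := by
        rw [e1, e2, one_mul, one_mul]
    _ = _ := by ring

/-- The norm over `E(x₀,t)` is at most the norm over `E(x₀,τ)` for every `τ > t`, so the Morrey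
bound at `τ` can be minimized over almost all such `τ`. -/
theorem eLpNorm_le_mul_essInf (hρ : IsQuasiDistance P ρ) {φ : E n → ℝ → ℝ}
    (hφ : IsWeight φ) (x₀ : E n) (q : ℝ) {f : E n → 𝕜} (hf : morreyNorm ρ x₀ q φ f ≠ ∞)
    {t : ℝ} (ht : 0 < t) :
    eLpNorm f (ENNReal.ofReal q) (volume.restrict (ellipsoid ρ x₀ t)) ≤
      ENNReal.ofReal (unitVolume ρ ^ (1 / q)) * morreyNorm ρ x₀ q φ f *
        essInf (fun τ : ℝ => ENNReal.ofReal (φ x₀ τ * τ ^ (P.trace / q)))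
          (volume.restrict (Set.Ioi t)) := by
  have hV := hρ.unitVolume_pos
  set M := ENNReal.ofReal (unitVolume ρ ^ (1 / q)) * morreyNorm ρ x₀ q φ f with hM
  have hMt : M ≠ ∞ := ENNReal.mul_ne_top ENNReal.ofReal_ne_top hf
  set X := eLpNorm f (ENNReal.ofReal q) (volume.restrict (ellipsoid ρ x₀ t))
  have hX : ∀ τ, t < τ → X ≤ M * ENNReal.ofReal (φ x₀ τ * τ ^ (P.trace / q)) := by
    intro τ hτ
    have hτ0 : 0 < τ := ht.trans hτ
    refine (eLpNorm_mono_measure _ (Measure.restrict_mono_set _ (ellipsoid_mono x₀ hτ.le))).trans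
      ((eLpNorm_le_mul_morreyNorm hρ hφ x₀ q f hτ0).trans_eq ?_)
    rw [hρ.volume_ellipsoid_rpow x₀ hτ0, hM, ENNReal.ofReal_mul (by positivity),
      ENNReal.ofReal_mul (hφ.2 x₀ τ hτ0).le, mul_one_div]
    ring
  have h1 : X / M ≤ essInf (fun τ : ℝ => ENNReal.ofReal (φ x₀ τ * τ ^ (P.trace / q)))
      (volume.restrict (Set.Ioi t)) := by
    refine le_essInf_of_ae_le _ ?_
    rw [EventuallyLE, ae_restrict_iff' measurableSet_Ioi]
    exact Eventually.of_forall fun τ hτ => ENNReal.div_le_of_le_mul' (hX τ hτ)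
  -- Multiplying `X / M` back by `M` fails when `M = 0`; then a single `τ` already gives `X = 0`.
  rcases eq_or_ne M 0 with h0 | h0
  · have := hX (t + 1) (lt_add_one t)
    rw [h0, zero_mul] at this
    exact this.trans zero_le
  · calc X = M * (X / M) := (ENNReal.mul_div_cancel h0 hMt).symm
      _ ≤ _ := by gcongr

/-- Let `e` be the exponent of `t` in the hypothesis. The `j`-th summand carries `2^(j(1-e))`, which
up to powers of `4 k r` is the interval length `R_j` times `R_j^{-e}`, so it is dominated by the
integral over that interval. The leftover `r^(e-1)` and the `r^σ` of the hypothesis give the stated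
power of `r`. -/
theorem exists_logSum_le (hρ : IsQuasiDistance P ρ) {φ₁ φ₂ : E n → ℝ → ℝ} (hφ₁ : IsWeight φ₁)
    (hφ₂ : IsWeight φ₂)
    (x₀ : E n) {p₁ lam σ : ℝ} {k : ℝ} (hk : 1 ≤ k)
    (hcond : LogEssInfCondition x₀ P.trace p₁ lam σ φ₁ φ₂) :
    ∃ C : ℝ, 0 ≤ C ∧ ∀ f : E n → 𝕜, morreyNorm ρ x₀ p₁ φ₁ f ≠ ∞ → ∀ r : ℝ, 0 < r →
      logSum ρ k x₀ p₁ (σ - P.trace / p₁ + P.trace * lam) r f ≤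
        ENNReal.ofReal (C * φ₂ x₀ r * r ^ (P.trace / p₁ - P.trace * lam)) *
          morreyNorm ρ x₀ p₁ φ₁ f := by
  have hV := hρ.unitVolume_pos
  obtain ⟨C₀, hC₀, H⟩ := hcond
  set e := P.trace / p₁ - σ + 1 - P.trace * lam with he
  -- For `R_j < t ≤ 2 R_j` this gives `t^e ≤ c R_j^e` for either sign of `e`.
  set c := max 1 ((2 : ℝ) ^ e) with hc
  have hc0 : 0 < c := by positivity
  refine ⟨2 * c * (4 * k) ^ (e - 1) * unitVolume ρ ^ (1 / p₁) * C₀, by positivity,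
    fun f hf r hr => ?_⟩
  have hφr := hφ₂.2 x₀ r hr
  set N := morreyNorm ρ x₀ p₁ φ₁ f
  set M := ENNReal.ofReal (unitVolume ρ ^ (1 / p₁)) * N with hM
  have hMt : M ≠ ∞ := ENNReal.mul_ne_top ENNReal.ofReal_ne_top hf
  set W : ℝ → ℝ≥0∞ := fun t => essInf
    (fun τ : ℝ => ENNReal.ofReal (φ₁ x₀ τ * τ ^ (P.trace / p₁))) (volume.restrict (Set.Ioi t))
  set X : ℕ → ℝ≥0∞ := fun j =>
    eLpNorm f (ENNReal.ofReal p₁) (volume.restrict (ellipsoid ρ x₀ (radius k r j)))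
  set G : ℝ → ℝ≥0∞ := fun t => ENNReal.ofReal (1 + Real.log (t / r)) * W t / ENNReal.ofReal (t ^ e)
  have hpt : ∀ j : ℕ, ∀ t, radius k r j < t → t ≤ radius k r (j + 1) →
      ENNReal.ofReal ((1 + j) / 2 / (c * radius k r j ^ e)) * X j ≤ M * G t := by
    intro j t h1 h2
    have hRj := radius_pos hk hr j
    have ht : 0 < t := hRj.trans h1
    rw [radius_succ] at h2
    -- Here `t / r ≥ 2^j` and `ln 2 > 1/2`.
    have hlog : (1 + (j : ℝ)) / 2 ≤ 1 + Real.log (t / r) := by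
      have h3 : (2 : ℝ) ^ j ≤ t / r := by
        rw [le_div_iff₀ hr]
        refine le_trans ?_ h1.le
        unfold radius
        have : r ≤ 4 * k * r := by nlinarith
        rw [mul_comm]
        gcongr
      have h4 := Real.log_le_log (by positivity) h3
      rw [Real.log_pow] at h4
      have h5 := Real.log_two_gt_d9
      have h6 : (j : ℝ) * (1 / 2) ≤ j * Real.log 2 := by gcongr; linarith
      linarith
    have hte : t ^ e ≤ c * radius k r j ^ e := by
      rcases le_total 0 e with h0 | h0
      · calc t ^ e ≤ (2 * radius k r j) ^ e := by gcongr
          _ = 2 ^ e * radius k r j ^ e := Real.mul_rpow two_pos.le hRj.le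
          _ ≤ _ := by gcongr; exact le_max_right _ _
      · calc t ^ e ≤ radius k r j ^ e := Real.rpow_le_rpow_of_nonpos hRj h1.le h0
          _ ≤ _ := le_mul_of_one_le_left (by positivity) (le_max_left _ _)
    have hXW : X j ≤ M * W t :=
      (eLpNorm_mono_measure _ (Measure.restrict_mono_set _ (ellipsoid_mono x₀ h1.le))).trans
        (eLpNorm_le_mul_essInf hρ hφ₁ x₀ p₁ hf ht)
    have hte0 : 0 < t ^ e := by positivity
    calc ENNReal.ofReal ((1 + j) / 2 / (c * radius k r j ^ e)) * X j
        ≤ ENNReal.ofReal ((1 + Real.log (t / r)) / t ^ e) * (M * W t) := by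
          have : 0 ≤ 1 + Real.log (t / r) := le_trans (by positivity) hlog
          gcongr
      _ = M * G t := by
          simp only [G]
          rw [ENNReal.ofReal_div_of_pos hte0, ENNReal.div_eq_inv_mul, ENNReal.div_eq_inv_mul]
          ring
  have hsum := tsum_mul_radius_le_lintegral hk hr hpt
  rw [lintegral_const_mul' _ _ hMt] at hsum
  have hterm : ∀ j : ℕ, ENNReal.ofReal ((1 + j) * ((2 : ℝ) ^ j) ^ (1 - e)) * X j =
      ENNReal.ofReal (2 * c * (4 * k * r) ^ (e - 1)) *
        (ENNReal.ofReal ((1 + j) / 2 / (c * radius k r j ^ e)) * X j *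
          ENNReal.ofReal (radius k r j)) := by
    intro j
    have hRj := radius_pos hk hr j
    have hcomm : ∀ A B D Y : ℝ≥0∞, A * (B * Y * D) = A * B * D * Y := fun A B D Y => by ring
    rw [hcomm, ← ENNReal.ofReal_mul (by positivity), ← ENNReal.ofReal_mul (by positivity)]
    congr 2
    have h1 : radius k r j ^ (1 - e) = (4 * k * r) ^ (1 - e) * ((2 : ℝ) ^ j) ^ (1 - e) :=
      Real.mul_rpow (by positivity) (by positivity)
    have h2 : radius k r j ^ (1 - e) = radius k r j / radius k r j ^ e := by
      rw [Real.rpow_sub hRj, Real.rpow_one]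
    have h3 : (4 * k * r) ^ (e - 1) * (4 * k * r) ^ (1 - e) = 1 := by
      rw [← Real.rpow_add (by positivity)]
      simp
    have h4 : ((2 : ℝ) ^ j) ^ (1 - e) =
        (4 * k * r) ^ (e - 1) * (radius k r j / radius k r j ^ e) := by
      rw [← h2, h1, ← mul_assoc, h3, one_mul]
    rw [h4]
    have h5 : radius k r j ^ e ≠ 0 := (Real.rpow_pos_of_pos hRj e).ne'
    field_simp
  have hexp : σ - P.trace / p₁ + P.trace * lam = 1 - e := by rw [he]; ring
  calc logSum ρ k x₀ p₁ (σ - P.trace / p₁ + P.trace * lam) r f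
      = ENNReal.ofReal (2 * c * (4 * k * r) ^ (e - 1)) *
        ∑' j : ℕ, ENNReal.ofReal ((1 + j) / 2 / (c * radius k r j ^ e)) * X j *
          ENNReal.ofReal (radius k r j) := by
        rw [← ENNReal.tsum_mul_left, hexp]
        exact tsum_congr hterm
    _ ≤ ENNReal.ofReal (2 * c * (4 * k * r) ^ (e - 1)) *
        (M * ENNReal.ofReal (C₀ * φ₂ x₀ r * r ^ σ)) := by
        gcongr
        exact hsum.trans (by gcongr; exact H r hr)
    _ = _ := by
        have h1 : r ^ (P.trace / p₁ - P.trace * lam) = r ^ (e - 1) * r ^ σ := by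
          rw [← Real.rpow_add hr]
          congr 1
          rw [he]; ring
        rw [h1, hM, Real.mul_rpow (by positivity) hr.le, mul_comm _ N, mul_assoc N, mul_left_comm,
          ← ENNReal.ofReal_mul (by positivity), ← ENNReal.ofReal_mul (by positivity), mul_comm N]
        congr 2
        ring

end LogSum

end

/-! ### The commutator: truncated estimate and passage to the limit -/

section

variable {n : ℕ} {P : Matrix (Fin n) (Fin n) ℝ} {ρ : E n → ℝ} {𝕜 : Type*} [RCLike 𝕜]
  {s : ℝ≥0∞} {Ω : E n → ℝ} {T : (E n → 𝕜) → (E n → 𝕜)} {p p₁ p₂ lam : ℝ}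

theorem holderTriple_ofReal (hp : 0 < p) (hp₁ : 0 < p₁) (hp₂ : 0 < p₂)
    (hpp : 1 / p = 1 / p₁ + 1 / p₂) :
    ENNReal.HolderTriple (ENNReal.ofReal p₂) (ENNReal.ofReal p₁) (ENNReal.ofReal p) := by
  refine ⟨?_⟩
  rw [← ENNReal.ofReal_inv_of_pos hp, ← ENNReal.ofReal_inv_of_pos hp₁,
    ← ENNReal.ofReal_inv_of_pos hp₂, ← ENNReal.ofReal_add (by positivity) (by positivity)]
  congr 1
  simp only [one_div] at hpp
  rw [hpp, add_comm]

/-- Hölder on each dyadic ellipsoid: the growth of `c` shifts the exponent by `m`, and its factor `1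
+ j` turns a dyadic sum into a logarithmic one. -/
theorem dyadicSum_mul_le [ENNReal.HolderTriple (ENNReal.ofReal p₂) (ENNReal.ofReal p₁)
      (ENNReal.ofReal p)] {k r κ κ' m : ℝ} {x₀ : E n}
    (hκ : κ + m = κ') {c g : E n → 𝕜} (hc : AEStronglyMeasurable c volume)
    (hg : AEStronglyMeasurable g volume) {Q : ℝ≥0∞}
    (hQ : ∀ j : ℕ, eLpNorm c (ENNReal.ofReal p₂)
      (volume.restrict (ellipsoid ρ x₀ (radius k r j))) ≤
        Q * ENNReal.ofReal ((1 + j) * ((2 : ℝ) ^ j) ^ m)) :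
    dyadicSum ρ k x₀ p κ r (c * g) ≤ Q * logSum ρ k x₀ p₁ κ' r g := by
  unfold dyadicSum logSum
  rw [← ENNReal.tsum_mul_left]
  refine ENNReal.tsum_le_tsum fun j => ?_
  have h2 : (0 : ℝ) < 2 ^ j := by positivity
  calc _ ≤ ENNReal.ofReal (((2 : ℝ) ^ j) ^ κ) * ((Q * ENNReal.ofReal ((1 + j) * ((2 : ℝ) ^ j) ^ m)) *
        eLpNorm g (ENNReal.ofReal p₁) (volume.restrict (ellipsoid ρ x₀ (radius k r j)))) := by
        gcongr
        refine (eLpNorm_smul_le_mul_eLpNorm (p := ENNReal.ofReal p₂) (q := ENNReal.ofReal p₁)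
          hg.restrict hc.restrict).trans ?_
        gcongr
        exact hQ j
    _ = _ := by
        rw [← hκ, Real.rpow_add h2, mul_left_comm (1 + (j : ℝ)),
          ENNReal.ofReal_mul (p := ((2 : ℝ) ^ j) ^ κ) (by positivity)]
        ring

theorem memLp_mul_of_support (hρ : IsQuasiDistance P ρ)
    [ENNReal.HolderTriple (ENNReal.ofReal p₂) (ENNReal.ofReal p₁) (ENNReal.ofReal p)]
    {c g : E n → 𝕜} (hc : MemLpLoc c (ENNReal.ofReal p₂)) (hg : MemLp g (ENNReal.ofReal p₁) volume)
    (hgb : Bornology.IsBounded (Function.support g)) :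
    MemLp (c * g) (ENNReal.ofReal p) volume := by
  obtain ⟨R, hR, hsub⟩ := hρ.exists_subset_ellipsoid 0 hgb
  have h1 : MemLp ((ellipsoid ρ 0 R).indicator c) (ENNReal.ofReal p₂) volume :=
    hc.indicator (hρ.measurableSet_ellipsoid 0 R) (hρ.isBounded_ellipsoid 0 R)
  have h2 : c * g = (ellipsoid ρ 0 R).indicator c * g := by
    funext x
    by_cases hx : g x = 0
    · simp [hx]
    · simp [Set.indicator_of_mem (hsub hx)]
  rw [h2]
  exact hg.mul h1

theorem MemLpLoc.sub_const {b : E n → 𝕜} {a : ℝ≥0∞} (hb : MemLpLoc b a) (c : 𝕜) :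
    MemLpLoc (fun y => b y - c) a := fun K hK => by
  have : IsFiniteMeasure ((volume : Measure (E n)).restrict K) :=
    isFiniteMeasure_restrict.2 hK.measure_ne_top
  exact (hb K hK).sub (memLp_const c)

theorem MemLpLoc.mul [ENNReal.HolderTriple (ENNReal.ofReal p₂) (ENNReal.ofReal p₁)
      (ENNReal.ofReal p)] {b f : E n → 𝕜} (hb : MemLpLoc b (ENNReal.ofReal p₂))
    (hf : MemLpLoc f (ENNReal.ofReal p₁)) : MemLpLoc (b * f) (ENNReal.ofReal p) :=
  fun K hK => (hf K hK).mul (hb K hK)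

/-- The commutator acting on functions with bounded support. -/
theorem exists_eLpNorm_commutator_le (hρ : IsQuasiDistance P ρ) (hT : IsBoundedLinear T)
    (hp : 1 < p) (hp₁ : p < p₁) (hp₂ : 1 ≤ p₂) (hpp : 1 / p = 1 / p₁ + 1 / p₂)
    (hlam : 0 ≤ lam) {k : ℝ} (hk : 1 ≤ k) (x₀ : E n) {σ : ℝ} {C₁ C₂ : ℝ≥0}
    (hC₁ : ∀ r : ℝ, 0 < r → ∀ g : E n → 𝕜,
      MemLp g (ENNReal.ofReal p) volume → Bornology.IsBounded (Function.support g) →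
      eLpNorm (T g) (ENNReal.ofReal p) (volume.restrict (ellipsoid ρ x₀ r)) ≤
        C₁ * dyadicSum ρ k x₀ p (σ - P.trace / p) r g)
    (hC₂ : ∀ r : ℝ, 0 < r → ∀ g : E n → 𝕜,
      MemLp g (ENNReal.ofReal p₁) volume → Bornology.IsBounded (Function.support g) →
      eLpNorm (T g) (ENNReal.ofReal p₁) (volume.restrict (ellipsoid ρ x₀ r)) ≤
        C₂ * dyadicSum ρ k x₀ p₁ (σ - P.trace / p₁) r g) :
    ∃ C : ℝ, 0 ≤ C ∧ ∀ b : E n → 𝕜, MemLpLoc b (ENNReal.ofReal p₂) → ∀ g : E n → 𝕜,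
      MemLp g (ENNReal.ofReal p₁) volume → Bornology.IsBounded (Function.support g) →
      ∀ r : ℝ, 0 < r →
      eLpNorm (b * T g - T (b * g)) (ENNReal.ofReal p) (volume.restrict (ellipsoid ρ x₀ r)) ≤
        ENNReal.ofReal (C * r ^ (P.trace * (1 / p₂ + lam))) * campanatoNorm ρ x₀ p₂ lam b *
          logSum ρ k x₀ p₁ (σ - P.trace / p₁ + P.trace * lam) r g := by
  have hp1' : 1 < ENNReal.ofReal p := by simpa using hp
  have hpt : ENNReal.ofReal p < ∞ := ENNReal.ofReal_lt_top
  have hp₁1 : 1 < ENNReal.ofReal p₁ := by simpa using hp.trans hp₁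
  have hH := holderTriple_ofReal (by linarith) (by linarith) (by linarith) hpp
  have hγ := hρ.trace_nonneg
  obtain ⟨C, hC, hosc⟩ := exists_eLpNorm_sub_average_le (𝕜 := 𝕜) hρ hp₂ hlam hk
  refine ⟨C * (C₁ + C₂), by positivity, fun b hb g hg hgb r hr => ?_⟩
  set m := P.trace * (1 / p₂ + lam) with hm
  set N := campanatoNorm ρ x₀ p₂ lam b
  set β := ⨍ z in ellipsoid ρ x₀ (radius k r 0), b z
  set c : E n → 𝕜 := fun y => b y - β with hc_def
  have hc : MemLpLoc c (ENNReal.ofReal p₂) := hb.sub_const β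
  have hcg := memLp_mul_of_support (p := p) (p₁ := p₁) hρ hc hg hgb
  have hcgb : Bornology.IsBounded (Function.support (c * g)) :=
    hgb.subset (Function.support_mul_subset_right c g)
  have hgp : MemLp g (ENNReal.ofReal p) volume := by
    obtain ⟨R, hR, hsub⟩ := hρ.exists_subset_ellipsoid 0 hgb
    refine hg.mono_exponent_of_measure_support_ne_top (s := ellipsoid ρ 0 R) (fun y hy => ?_)
      (hρ.volume_ellipsoid_ne_top _ _) (ENNReal.ofReal_le_ofReal hp₁.le)
    by_contra h
    exact hy (hsub h)
  obtain ⟨B₁, hB₁⟩ := hT.bounded _ hp1' hpt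
  obtain ⟨B₂, hB₂⟩ := hT.bounded _ hp₁1 ENNReal.ofReal_lt_top
  have hsplit : b * g = c * g + β • g := by
    funext x
    simp [hc_def]
    ring
  -- The constant `β` cancels by linearity in `L_p`, which applies because both `c * g` and `g` lie
  -- in `L_p`, thanks to the bounded support.
  have hlin : b * T g - T (b * g) =ᵐ[volume] c * T g - T (c * g) := by
    have h1 := hT.map_add _ hp1' hpt _ _ hcg (hgp.const_smul β)
    rw [← hsplit] at h1
    filter_upwards [h1, hT.map_smul _ hp1' hpt β g hgp] with x hx hx'
    simp only [Pi.sub_apply, Pi.mul_apply, hx, Pi.add_apply, hx', Pi.smul_apply, smul_eq_mul,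
      hc_def]
    ring
  rw [eLpNorm_congr_ae (ae_restrict_of_ae hlin)]
  set Q := ENNReal.ofReal (C * r ^ m) * N with hQ
  set L := logSum ρ k x₀ p₁ (σ - P.trace / p₁ + P.trace * lam) r g
  have hle0 : r ≤ radius k r 0 := by
    unfold radius; rw [pow_zero, mul_one]; nlinarith
  -- On `E(x₀,r)` the factor `c` is measured by its oscillation at level `j = 0`, and `T g` by the
  -- `L_{p₁}` estimate.
  have h1 : eLpNorm (c * T g) (ENNReal.ofReal p) (volume.restrict (ellipsoid ρ x₀ r)) ≤
      Q * (C₂ * L) := by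
    refine (eLpNorm_smul_le_mul_eLpNorm (p := ENNReal.ofReal p₂) (q := ENNReal.ofReal p₁)
      (hB₂ g hg).1.1.restrict hc.aestronglyMeasurable.restrict).trans ?_
    gcongr
    · refine (eLpNorm_mono_measure _ (Measure.restrict_mono_set _
        (ellipsoid_mono x₀ hle0))).trans ((hosc x₀ b hb r hr 0).trans_eq ?_)
      simp [hQ, N, hm]
    · refine (hC₂ r hr g hg hgb).trans ?_
      gcongr
      exact dyadicSum_le_logSum k x₀ p₁ r (le_add_of_nonneg_right (by positivity)) g
  -- Here the oscillation is needed at every level; `1/p = 1/p₁ + 1/p₂` turns the exponent `σ - γ/p`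
  -- plus `m` into that of the logarithmic sum.
  have h2 : eLpNorm (T (c * g)) (ENNReal.ofReal p) (volume.restrict (ellipsoid ρ x₀ r)) ≤
      C₁ * (Q * L) := by
    refine (hC₁ r hr _ hcg hcgb).trans ?_
    gcongr
    refine dyadicSum_mul_le (p₂ := p₂) (m := m) ?_ hc.aestronglyMeasurable hg.1
      (fun j => hosc x₀ b hb r hr j)
    rw [hm, div_eq_mul_one_div, hpp]
    ring
  calc _ ≤ Q * (C₂ * L) + C₁ * (Q * L) :=
        (eLpNorm_sub_le (hc.aestronglyMeasurable.mul (hB₂ g hg).1.1).restrict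
          (hB₁ _ hcg).1.1.restrict hp1'.le).trans (add_le_add h1 h2)
    _ = _ := by
        have : ENNReal.ofReal (C * (C₁ + C₂) * r ^ m) = ENNReal.ofReal (C * r ^ m) * (C₁ + C₂) := by
          rw [mul_right_comm, ENNReal.ofReal_mul (by positivity),
            ENNReal.ofReal_add C₁.coe_nonneg C₂.coe_nonneg, ENNReal.ofReal_coe_nnreal, ENNReal.ofReal_coe_nnreal]
        rw [this, hQ]
        ring

/-- Passage to the limit in the truncations of `f`. -/
theorem eLpNorm_commutator_le_of_truncations {b f u : E n → 𝕜}
    (hb : AEStronglyMeasurable b volume)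
    (hf : ∀ R, AEStronglyMeasurable (T ((ellipsoid ρ 0 R).indicator f)) volume)
    (hbf : ∀ R, AEStronglyMeasurable (T ((ellipsoid ρ 0 R).indicator (b * f))) volume)
    (hu : IsCommutator ρ b T f u) {S : Set (E n)} (hS : Bornology.IsBounded S)
    {a : ℝ≥0∞} {D : ℝ≥0∞}
    (hD : ∀ R, eLpNorm (b * T ((ellipsoid ρ 0 R).indicator f) -
      T ((ellipsoid ρ 0 R).indicator (b * f))) a (volume.restrict S) ≤ D) :
    eLpNorm u a (volume.restrict S) ≤ D := by
  obtain ⟨g, h, ⟨hgm, hg⟩, ⟨hhm, hh⟩, hu⟩ := hu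
  have hle : volume.restrict S ≤ (volume : Measure (E n)).restrict (closure S) :=
    Measure.restrict_mono_set _ subset_closure
  have conv : ∀ (F : ℝ → E n → 𝕜) (G : E n → 𝕜),
      Tendsto (fun R => eLpNorm (F R - G) 1 (volume.restrict (closure S))) atTop (𝓝 0) →
      (∀ R, AEStronglyMeasurable (F R) volume) → AEStronglyMeasurable G volume →
      ∀ v : ℕ → ℝ, Tendsto v atTop atTop → ∃ w : ℕ → ℕ, StrictMono w ∧
        ∀ᵐ x ∂(volume.restrict S), Tendsto (fun i => F (v (w i)) x) atTop (𝓝 (G x)) := by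
    intro F G hFG hF hG v hv
    have h1 : Tendsto (fun i => eLpNorm (F (v i) - G) 1 (volume.restrict S)) atTop (𝓝 0) :=
      tendsto_of_tendsto_of_tendsto_of_le_of_le tendsto_const_nhds (hFG.comp hv)
        (fun _ => zero_le) fun i => eLpNorm_mono_measure _ hle
    exact (tendstoInMeasure_of_tendsto_eLpNorm one_ne_zero (fun i => (hF _).restrict)
      hG.restrict h1).exists_seq_tendsto_ae
  obtain ⟨w, hw, hwl⟩ := conv _ g (hg _ hS.isCompact_closure) hf hgm (fun i : ℕ => (i : ℝ))
    tendsto_natCast_atTop_atTop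
  have hv : Tendsto (fun i : ℕ => ((w i : ℕ) : ℝ)) atTop atTop :=
    tendsto_natCast_atTop_atTop.comp hw.tendsto_atTop
  -- Extracting a subsequence of the one already chosen makes both truncated values converge almost
  -- everywhere along the same indices; Fatou then gives the bound.
  obtain ⟨w', hw', hwl'⟩ := conv _ h (hh _ hS.isCompact_closure) hbf hhm _ hv
  refine Lp.eLpNorm_le_of_ae_tendsto (u := atTop)
    (f := fun i : ℕ => b * T ((ellipsoid ρ 0 (w (w' i))).indicator f) -
      T ((ellipsoid ρ 0 (w (w' i))).indicator (b * f)))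
    (Eventually.of_forall fun i => hD _)
    (fun i => ((hb.mul (hf _)).sub (hbf _)).restrict) ?_
  filter_upwards [hwl, hwl', ae_restrict_of_ae hu] with x h1 h2 h3
  rw [h3]
  exact ((h1.comp hw'.tendsto_atTop).const_mul (b x)).sub h2

/-- The two limits are obtained separately, for `f` at exponent `p₁` and for `b f` at exponent `p`.
In the second, `b` is its oscillation plus the constant `β`, whose dyadic norms grow no faster; `Q`
may depend on `r`, `b` and `β` because only finiteness matters. -/
theorem exists_commutator (hρ : IsQuasiDistance P ρ) (hT : IsBoundedLinear T)
    (hp : 1 < p) (hp₁ : p < p₁) (hp₂ : 1 ≤ p₂) (hpp : 1 / p = 1 / p₁ + 1 / p₂)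
    (hlam : 0 ≤ lam) {k : ℝ} (hk : 1 ≤ k) (x₀ : E n) {σ : ℝ} {C₁ C₂ : ℝ≥0}
    (hC₁ : ∀ r : ℝ, 0 < r → ∀ g : E n → 𝕜,
      MemLp g (ENNReal.ofReal p) volume → Bornology.IsBounded (Function.support g) →
      eLpNorm (T g) (ENNReal.ofReal p) (volume.restrict (ellipsoid ρ x₀ r)) ≤
        C₁ * dyadicSum ρ k x₀ p (σ - P.trace / p) r g)
    (hC₂ : ∀ r : ℝ, 0 < r → ∀ g : E n → 𝕜,
      MemLp g (ENNReal.ofReal p₁) volume → Bornology.IsBounded (Function.support g) →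
      eLpNorm (T g) (ENNReal.ofReal p₁) (volume.restrict (ellipsoid ρ x₀ r)) ≤
        C₂ * dyadicSum ρ k x₀ p₁ (σ - P.trace / p₁) r g)
    {b f : E n → 𝕜} (hb : MemCampanato ρ x₀ p₂ lam b) (hf : MemLpLoc f (ENNReal.ofReal p₁))
    (hsum : ∀ r : ℝ, 0 < r →
      logSum ρ k x₀ p₁ (σ - P.trace / p₁ + P.trace * lam) r f ≠ ∞) :
    ∃ u, IsCommutator ρ b T f u := by
  have hγ := hρ.trace_nonneg
  have hV := hρ.unitVolume_pos
  have hH := holderTriple_ofReal (by linarith) (by linarith) (by linarith) hpp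
  have hp₂0 : 0 < p₂ := by linarith
  obtain ⟨g, hg⟩ := exists_hasValue hρ hT (hp.trans hp₁) x₀ hC₂ hf fun r hr =>
    ne_top_of_le_ne_top (hsum r hr) (dyadicSum_le_logSum k x₀ p₁ r
      (le_add_of_nonneg_right (by positivity)) f)
  obtain ⟨h, hh⟩ := exists_hasValue hρ hT hp x₀ hC₁ (hb.1.mul hf) fun r hr => by
    obtain ⟨C, hC, hosc⟩ := exists_eLpNorm_sub_average_le (𝕜 := 𝕜) hρ hp₂ hlam hk
    set m := P.trace * (1 / p₂ + lam) with hm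
    set β := ⨍ z in ellipsoid ρ x₀ (radius k r 0), b z
    set Q := ENNReal.ofReal (C * r ^ m) * campanatoNorm ρ x₀ p₂ lam b +
      ‖β‖ₑ * ENNReal.ofReal (unitVolume ρ ^ (1 / p₂) * (4 * k * r) ^ (P.trace * (1 / p₂))) with hQ
    have hQt : Q ≠ ∞ := ENNReal.add_ne_top.2
      ⟨ENNReal.mul_ne_top ENNReal.ofReal_ne_top hb.2.ne,
        ENNReal.mul_ne_top enorm_ne_top ENNReal.ofReal_ne_top⟩
    refine ne_top_of_le_ne_top (ENNReal.mul_ne_top hQt (hsum r hr))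
      (dyadicSum_mul_le (p₂ := p₂) (m := m) ?_ hb.1.aestronglyMeasurable hf.aestronglyMeasurable
        fun j => ?_)
    · rw [hm, div_eq_mul_one_div, hpp]
      ring
    · have hR := radius_pos hk hr j
      have hsplit : b = (fun y => b y - β) + fun _ => β := by
        funext y; simp
      have hconst : eLpNorm (fun _ : E n => β) (ENNReal.ofReal p₂)
          (volume.restrict (ellipsoid ρ x₀ (radius k r j))) ≤
          ‖β‖ₑ * ENNReal.ofReal (unitVolume ρ ^ (1 / p₂) * (4 * k * r) ^ (P.trace * (1 / p₂))) *
            ENNReal.ofReal ((1 + j) * ((2 : ℝ) ^ j) ^ m) := by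
        rw [eLpNorm_const' _ (by simpa using hp₂0) ENNReal.ofReal_ne_top,
          Measure.restrict_apply_univ, ENNReal.toReal_ofReal hp₂0.le,
          hρ.volume_ellipsoid_rpow x₀ hR, mul_assoc, ← ENNReal.ofReal_mul (by positivity)]
        refine mul_le_mul_right (ENNReal.ofReal_le_ofReal ?_) _
        have e1 : radius k r j ^ (P.trace * (1 / p₂)) =
            (4 * k * r) ^ (P.trace * (1 / p₂)) * ((2 : ℝ) ^ j) ^ (P.trace * (1 / p₂)) :=
          Real.mul_rpow (by positivity) (by positivity)
        rw [e1, ← mul_assoc]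
        refine mul_le_mul_of_nonneg_left ?_ (by positivity)
        have e2 : ((2 : ℝ) ^ j) ^ (P.trace * (1 / p₂)) ≤ ((2 : ℝ) ^ j) ^ m :=
          Real.rpow_le_rpow_of_exponent_le (one_le_pow₀ one_le_two)
            (mul_le_mul_of_nonneg_left (by linarith) hγ)
        refine e2.trans (le_mul_of_one_le_left (by positivity) ?_)
        linarith [(Nat.cast_nonneg j : (0 : ℝ) ≤ j)]
      have hadd := eLpNorm_add_le (μ := volume.restrict (ellipsoid ρ x₀ (radius k r j)))
        (p := ENNReal.ofReal p₂)
        (hb.1.sub_const β).aestronglyMeasurable.restrict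
        (aestronglyMeasurable_const (b := β)) (by simpa using hp₂)
      rw [← hsplit] at hadd
      rw [hQ, add_mul]
      exact hadd.trans (add_le_add (hosc x₀ b hb.1 r hr j) hconst)
  exact ⟨b * g - h, g, h, hg, hh, EventuallyEq.rfl⟩

theorem morreyNorm_le_of_forall (hρ : IsQuasiDistance P ρ) {φ : E n → ℝ → ℝ} (hφ : IsWeight φ)
    {x₀ : E n} {C : ℝ} {D : ℝ≥0∞} {u : E n → 𝕜}
    (h : ∀ r : ℝ, 0 < r →
      eLpNorm u (ENNReal.ofReal p) (volume.restrict (ellipsoid ρ x₀ r)) ≤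
        ENNReal.ofReal (C * φ x₀ r * r ^ (P.trace / p)) * D) :
    morreyNorm ρ x₀ p φ u ≤ ENNReal.ofReal (C * unitVolume ρ ^ (-(1 / p))) * D := by
  have hV := hρ.unitVolume_pos
  refine iSup₂_le fun r hr => ?_
  have hφr := hφ.2 x₀ r hr
  calc _ ≤ (ENNReal.ofReal (φ x₀ r))⁻¹ * volume (ellipsoid ρ x₀ r) ^ (-(1 / p)) *
        (ENNReal.ofReal (C * φ x₀ r * r ^ (P.trace / p)) * D) := by
        gcongr
        exact h r hr
    _ = _ := by
        rw [hρ.volume_ellipsoid_rpow x₀ hr, ← ENNReal.ofReal_inv_of_pos hφr, ← mul_assoc,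
          ← ENNReal.ofReal_mul (by positivity), ← ENNReal.ofReal_mul (by positivity)]
        congr 2
        have : r ^ (P.trace * -(1 / p)) = (r ^ (P.trace / p))⁻¹ := by
          rw [← Real.rpow_neg hr.le]; congr 1; ring
        rw [this]
        have := (Real.rpow_pos_of_pos hr (P.trace / p)).ne'
        field_simp

end

end ParabolicMorrey

end

/-! ### Assembly of the theorem -/

theorem theorem4p3 {𝕜 : Type*} [RCLike 𝕜] (n : ℕ) (hn : 2 ≤ n)
    (P : Matrix (Fin n) (Fin n) ℝ) (hP : ParabolicMorrey.HasPositiveEigenvalues P)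
    (ρ : ParabolicMorrey.E n → ℝ) (hρ : ParabolicMorrey.IsQuasiDistance P ρ)
    (s : ℝ≥0∞) (hs : 1 < s)
    (Ω : ParabolicMorrey.E n → ℝ) (hΩ : ParabolicMorrey.IsRoughKernel P s Ω)
    (T : (ParabolicMorrey.E n → 𝕜) → (ParabolicMorrey.E n → 𝕜))
    (hT : ParabolicMorrey.IsBoundedLinear T)
    (hsize : ParabolicMorrey.SizeCondition P ρ Ω T)
    (x₀ : ParabolicMorrey.E n)
    (p p₁ p₂ lam : ℝ) (hp : 1 < p) (hp₁ : 1 ≤ p₁) (hp₂ : 1 ≤ p₂)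
    (hpp : 1 / p = 1 / p₁ + 1 / p₂)
    (hlam : 0 ≤ lam) (hlam' : lam < 1 / P.trace)
    (φ₁ φ₂ : ParabolicMorrey.E n → ℝ → ℝ)
    (hφ₁ : ParabolicMorrey.IsWeight φ₁) (hφ₂ : ParabolicMorrey.IsWeight φ₂)
    (hφ : (ENNReal.conjExponent s ≤ ENNReal.ofReal p ∧
            ParabolicMorrey.LogEssInfCondition x₀ P.trace p₁ lam 0 φ₁ φ₂) ∨
          (ENNReal.ofReal p₁ < s ∧
            ParabolicMorrey.LogEssInfCondition x₀ P.trace p₁ lam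
              (P.trace * (s⁻¹).toReal) φ₁ φ₂)) :
    ∃ C : ℝ≥0, ∀ b : ParabolicMorrey.E n → 𝕜,
      ParabolicMorrey.MemCampanato ρ x₀ p₂ lam b →
      ∀ f : ParabolicMorrey.E n → 𝕜, ParabolicMorrey.MemMorrey ρ x₀ p₁ φ₁ f →
        (∃ u : ParabolicMorrey.E n → 𝕜, ParabolicMorrey.IsCommutator ρ b T f u) ∧
        ∀ u : ParabolicMorrey.E n → 𝕜, ParabolicMorrey.IsCommutator ρ b T f u →
          ParabolicMorrey.MemMorrey ρ x₀ p φ₂ u ∧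
          ParabolicMorrey.morreyNorm ρ x₀ p φ₂ u ≤
            C * ParabolicMorrey.campanatoNorm ρ x₀ p₂ lam b *
              ParabolicMorrey.morreyNorm ρ x₀ p₁ φ₁ f := by
  have hn0 : n ≠ 0 := by omega
  have hH := ParabolicMorrey.holderTriple_ofReal (by linarith) (by linarith) (by linarith) hpp
  -- Strict because `p₂` is finite; in particular `p₁ > 1`, so `T` is bounded on `L_{p₁}`.
  have hpp₁ : p < p₁ := by
    have h2 : 0 < 1 / p₂ := by positivity
    exact lt_of_one_div_lt_one_div (by linarith) (by linarith)
  obtain ⟨k, hk, htri⟩ := hρ.exists_triangle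
  -- The estimates at `p` and at `p₁` must share one loss `σ`: in case (i) `s' ≤ p < p₁`, in case
  -- (ii) `p < p₁ < s`.
  obtain ⟨σ, hadm, hadm₁, hcond⟩ : ∃ σ : ℝ, ParabolicMorrey.Admissible P s p σ ∧
      ParabolicMorrey.Admissible P s p₁ σ ∧
      ParabolicMorrey.LogEssInfCondition x₀ P.trace p₁ lam σ φ₁ φ₂ := by
    have hle : ENNReal.ofReal p ≤ ENNReal.ofReal p₁ := ENNReal.ofReal_le_ofReal hpp₁.le
    rcases hφ with ⟨h1, h2⟩ | ⟨h1, h2⟩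
    · exact ⟨0, Or.inl ⟨h1, rfl⟩, Or.inl ⟨h1.trans hle, rfl⟩, h2⟩
    · exact ⟨_, Or.inr ⟨hle.trans h1.le, rfl⟩, Or.inr ⟨h1.le, rfl⟩, h2⟩
  obtain ⟨C₁, hC₁⟩ := ParabolicMorrey.exists_eLpNorm_le_dyadicSum hρ hΩ hn0 hs hT hsize hp hadm
    hk htri
  obtain ⟨C₂, hC₂⟩ := ParabolicMorrey.exists_eLpNorm_le_dyadicSum hρ hΩ hn0 hs hT hsize
    (hp.trans hpp₁) hadm₁ hk htri
  obtain ⟨A, hA, hcomm⟩ := ParabolicMorrey.exists_eLpNorm_commutator_le hρ hT hp hpp₁ hp₂ hpp hlam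
    hk x₀ (hC₁ x₀) (hC₂ x₀)
  obtain ⟨B, hB, hlog⟩ := ParabolicMorrey.exists_logSum_le (𝕜 := 𝕜) hρ hφ₁ hφ₂ x₀ hk hcond
  refine ⟨(A * B * ParabolicMorrey.unitVolume ρ ^ (-(1 / p))).toNNReal, fun b hb f hf => ⟨?_, ?_⟩⟩
  · refine ParabolicMorrey.exists_commutator hρ hT hp hpp₁ hp₂ hpp hlam hk x₀ (hC₁ x₀) (hC₂ x₀)
      hb hf.1 fun r hr => ?_
    exact ne_top_of_le_ne_top (ENNReal.mul_ne_top ENNReal.ofReal_ne_top hf.2.ne)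
      (hlog f hf.2.ne r hr)
  intro u hu
  have hbf := hb.1.mul (p := p) hf.1
  have hTf : ∀ R, AEStronglyMeasurable (T ((ParabolicMorrey.ellipsoid ρ 0 R).indicator f))
      volume := fun R =>
    ((hT.bounded (ENNReal.ofReal p₁) (by simpa using hp.trans hpp₁)
      ENNReal.ofReal_lt_top).choose_spec _ (ParabolicMorrey.memLp_truncation hρ hf.1 R)).1.1
  have hTbf : ∀ R, AEStronglyMeasurable (T ((ParabolicMorrey.ellipsoid ρ 0 R).indicator (b * f)))
      volume := fun R =>
    ((hT.bounded (ENNReal.ofReal p) (by simpa using hp)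
      ENNReal.ofReal_lt_top).choose_spec _ (ParabolicMorrey.memLp_truncation hρ hbf R)).1.1
  have hmain : ∀ r : ℝ, 0 < r → eLpNorm u (ENNReal.ofReal p)
      (volume.restrict (ParabolicMorrey.ellipsoid ρ x₀ r)) ≤
      ENNReal.ofReal (A * B * φ₂ x₀ r * r ^ (P.trace / p)) *
        (ParabolicMorrey.campanatoNorm ρ x₀ p₂ lam b *
          ParabolicMorrey.morreyNorm ρ x₀ p₁ φ₁ f) := by
    intro r hr
    have hφr := hφ₂.2 x₀ r hr
    refine (ParabolicMorrey.eLpNorm_commutator_le_of_truncations hb.1.aestronglyMeasurable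
      hTf hTbf hu (hρ.isBounded_ellipsoid x₀ r)
      (D := ENNReal.ofReal (A * r ^ (P.trace * (1 / p₂ + lam))) *
        ParabolicMorrey.campanatoNorm ρ x₀ p₂ lam b *
        (ENNReal.ofReal (B * φ₂ x₀ r * r ^ (P.trace / p₁ - P.trace * lam)) *
          ParabolicMorrey.morreyNorm ρ x₀ p₁ φ₁ f)) fun R => ?_).trans_eq ?_
    -- Truncation commutes with multiplication by `b`, so the truncated expression is a commutator
    -- applied to a function of bounded support; monotonicity of `logSum` makes the bound
    -- independent of `R`.
    · have hind : (ParabolicMorrey.ellipsoid ρ 0 R).indicator (b * f) =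
          b * (ParabolicMorrey.ellipsoid ρ 0 R).indicator f := by
        funext x
        by_cases hx : x ∈ ParabolicMorrey.ellipsoid ρ 0 R <;> simp [hx]
      rw [hind]
      refine (hcomm b hb.1 _ (ParabolicMorrey.memLp_truncation hρ hf.1 R)
        ((hρ.isBounded_ellipsoid 0 R).subset Set.support_indicator_subset) r hr).trans ?_
      gcongr
      exact (ParabolicMorrey.logSum_mono k x₀ p₁ _ r fun x =>
        norm_indicator_le_norm_self _ _).trans (hlog f hf.2.ne r hr)
    · have e : r ^ (P.trace / p) =
          r ^ (P.trace * (1 / p₂ + lam)) * r ^ (P.trace / p₁ - P.trace * lam) := by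
        rw [← Real.rpow_add hr]
        congr 1
        rw [div_eq_mul_one_div P.trace p, hpp]
        ring
      have e' : A * B * φ₂ x₀ r * r ^ (P.trace / p) =
          (A * r ^ (P.trace * (1 / p₂ + lam))) *
            (B * φ₂ x₀ r * r ^ (P.trace / p₁ - P.trace * lam)) := by
        rw [e]; ring
      rw [e', ENNReal.ofReal_mul (p := A * _) (by positivity)]
      ring
  have hnorm := ParabolicMorrey.morreyNorm_le_of_forall hρ hφ₂ hmain
  rw [← mul_assoc] at hnorm
  refine ⟨⟨fun K hK => ?_, ?_⟩, hnorm⟩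
  · obtain ⟨r, hr, hsub⟩ := hρ.exists_subset_ellipsoid x₀ hK.isBounded
    obtain ⟨g, h, hg, hh, hu'⟩ := hu
    refine ⟨(((hb.1.aestronglyMeasurable.mul hg.1).sub hh.1).congr hu'.symm).restrict, ?_⟩
    refine ((eLpNorm_mono_measure _ (Measure.restrict_mono_set _ hsub)).trans
      (hmain r hr)).trans_lt ?_
    exact ENNReal.mul_lt_top ENNReal.ofReal_lt_top (ENNReal.mul_lt_top hb.2 hf.2)
  · exact hnorm.trans_lt (ENNReal.mul_lt_top (ENNReal.mul_lt_top ENNReal.coe_lt_top hb.2) hf.2)
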